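/- **Theorem (consistent quantum amplitude estimation).** A quantum query algorithm is a circuit: a sequence of steps on finitely many qubits, each of which is an arbitrary unitary on one or two qubits (a quantum gate) or one application of the oracle $U$ or of $U^\dagger$. Its running time is the number of its gates and oracle queries. On an input bit string $s$ the circuit starts in the computational basis state with $s$ on its input qubits and $0$ on all other qubits; at the end it is measured in the computational basis, and the bits $b_1,\dots,b_m$ read on its output qubits are its output, understood as the number $\sum_i b_i 2^{-i}$. There are constants $K$ and $k$ such that the following holds for all real $\varepsilon,\delta>0$. There are a length $\ell\le K\log(2+1/\varepsilon)$, that is, $\ell = O(\log(1/\varepsilon))$, and a function $f$ that assigns to each $s\in\{0,1\}^\ell$ and each $p\in[0,1]$ a number $f(s,p)\in[0,1]$, such that for every $n\ge 0$ there is a quantum query algorithm $\mathcal A$, taking $s\in\{0,1\}^\ell$ as input, with at most $$K\,\tfrac1\delta\log^k\!\left(2+\tfrac1\delta\right)\left(1+\tfrac1\varepsilon\right)^k=\widetilde O(\delta^{-1})\cdot\mathrm{poly}(\varepsilon^{-1})$$ oracle queries and running time at most $$K\,(n+1)\,\tfrac1\delta\log^k\!\left(2+\tfrac1\delta\right)\left(1+\tfrac1\varepsilon\right)^k,$$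 for which the following is true. Let $p\in[0,1]$ and let $U$ be any unitary operator on a qubit $A$ and an $n$-qubit system $B$ with $$U|0\rangle_A|0\rangle_B=\sqrt p\,|0\rangle_A|\phi_0\rangle_B+\sqrt{1-p}\,|1\rangle_A|\phi_1\rangle_B$$ for some unit vectors $|\phi_0\rangle,|\phi_1\rangle$. Let $s$ be uniformly random in $\{0,1\}^\ell$. Then 1. with probability at least $1-\varepsilon$ over $s$, both $|f(s,p)-p|\le\delta$ holds and $\mathcal A$ on input $s$ with oracle $U$ outputs exactly $f(s,p)$ with probability at least $1-\varepsilon$ over the measurement; 2. with probability at least $1-\varepsilon$ over $s$ and the measurement together, the output of $\mathcal A$ is $f(s,p)$ and $|f(s,p)-p|\le\delta$. Here $f$ depends only on $\varepsilon$ and $\delta$, and not on $n$ or $U$; $\mathcal A$ depends only on $\varepsilon$, $\delta$ and $n$, and not on $s$, $U$ or $p$. -/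

import Mathlib

open scoped Matrix

namespace QAmp

/-- Bit strings of length `k`; they label the computational basis of `k` qubits. -/
abbrev Bits (k : ℕ) : Type := Fin k → Fin 2

/-- The computational basis vector `|x⟩`. -/
def ket {k : ℕ} (x : Bits k) : Bits k → ℂ := fun y => if y = x then 1 else 0

/-- The vector `|a⟩_A |φ⟩_B` on `1 + n` qubits; `A` is qubit `0` and `B` is the remaining `n`. -/
def ketTensor {n : ℕ} (a : Fin 2) (φ : EuclideanSpace ℂ (Bits n)) : Bits (n + 1) → ℂ :=
  fun x => if x 0 = a then φ (Fin.tail x) else 0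

/-- The operator on `w` qubits that applies `M` to the qubits `e 0, e 1, …, e (k - 1)` (in this
order) and the identity to the other qubits. -/
def onWires {k w : ℕ} (e : Fin k ↪ Fin w) (M : Matrix (Bits k) (Bits k) ℂ) :
    Matrix (Bits w) (Bits w) ℂ :=
  open Classical in
  fun x y => if ∀ j, j ∉ Set.range e → x j = y j then M (x ∘ e) (y ∘ e) else 0

/-- One step of a quantum query circuit on `w` qubits: a quantum gate, that is, an arbitrary unitary
on one or two qubits, or one query to the oracle (a unitary on `n + 1` qubits) or to its inverse. -/
inductive Step (n w : ℕ) : Type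
  | gateOne (V : Matrix.unitaryGroup (Bits 1) ℂ) (e : Fin 1 ↪ Fin w) : Step n w
  | gateTwo (V : Matrix.unitaryGroup (Bits 2) ℂ) (e : Fin 2 ↪ Fin w) : Step n w
  | query (e : Fin (n + 1) ↪ Fin w) : Step n w
  | queryInv (e : Fin (n + 1) ↪ Fin w) : Step n w

/-- The operator that a step performs when the oracle is `U`. -/
def Step.toMatrix {n w : ℕ} (U : Matrix (Bits (n + 1)) (Bits (n + 1)) ℂ) :
    Step n w → Matrix (Bits w) (Bits w) ℂ
  | .gateOne V e => onWires e (V : Matrix (Bits 1) (Bits 1) ℂ)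
  | .gateTwo V e => onWires e (V : Matrix (Bits 2) (Bits 2) ℂ)
  | .query e => onWires e U
  | .queryInv e => onWires e Uᴴ

/-- Whether a step is an oracle query. -/
def Step.isQuery {n w : ℕ} : Step n w → Bool
  | .gateOne _ _ => false
  | .gateTwo _ _ => false
  | .query _ => true
  | .queryInv _ => true

/-- The operator `G_T ⋯ G_2 G_1` of a list `G_1, …, G_T` of steps, when the oracle is `U`. -/
def runSteps {n w : ℕ} (U : Matrix (Bits (n + 1)) (Bits (n + 1)) ℂ) :
    List (Step n w) → Matrix (Bits w) (Bits w) ℂ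
  | [] => 1
  | G :: Gs => runSteps U Gs * G.toMatrix U

/-- A quantum query algorithm with a classical input of `l` bits and an oracle on `n + 1` qubits:
a circuit on `width` qubits, with the qubits that hold the input at the start and the qubits
that are read out at the end. The circuit does not depend on the input or on the oracle. -/
structure QueryAlgorithm (n l : ℕ) where
  width : ℕ
  outLen : ℕ
  inWires : Fin l ↪ Fin width
  outWires : Fin outLen ↪ Fin width
  steps : List (Step n width)

namespace QueryAlgorithm

variable {n l : ℕ}

/-- The quantum time complexity: the number of gates and oracle queries. -/
def time (A : QueryAlgorithm n l) : ℕ := A.steps.length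

/-- The number of oracle queries. -/
def queries (A : QueryAlgorithm n l) : ℕ := A.steps.countP Step.isQuery

/-- The initial basis label: `s` on the input qubits and `0` on all the others. -/
noncomputable def start (A : QueryAlgorithm n l) (s : Bits l) : Bits A.width :=
  Function.extend A.inWires s (fun _ => 0)

/-- The state at the end of the execution on input `s` with oracle `U`. -/
noncomputable def finalState (A : QueryAlgorithm n l)
    (U : Matrix (Bits (n + 1)) (Bits (n + 1)) ℂ) (s : Bits l) : Bits A.width → ℂ :=
  runSteps U A.steps *ᵥ ket (A.start s)

/-- The real number `0.b₀b₁b₂…` (in binary) that is written on the output qubits. -/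
noncomputable def outValue (A : QueryAlgorithm n l) (x : Bits A.width) : ℝ :=
  ∑ i : Fin A.outLen, ((x (A.outWires i) : ℕ) : ℝ) / 2 ^ ((i : ℕ) + 1)

/-- The probability that the measurement of the final state in the computational basis shows the
number `v` on the output qubits. -/
noncomputable def outProb (A : QueryAlgorithm n l)
    (U : Matrix (Bits (n + 1)) (Bits (n + 1)) ℂ) (s : Bits l) (v : ℝ) : ℝ :=
  open Classical in
  ∑ x : Bits A.width with A.outValue x = v, ‖A.finalState U s x‖ ^ 2

end QueryAlgorithm

/-- `U|0⟩_A|0⟩_B = √p |0⟩_A|φ₀⟩_B + √(1-p) |1⟩_A|φ₁⟩_B` for some unit vectors `φ₀`, `φ₁`, where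
`U` is unitary and `0 ≤ p ≤ 1`. -/
def PreparesAmplitude {n : ℕ} (U : Matrix (Bits (n + 1)) (Bits (n + 1)) ℂ) (p : ℝ) : Prop :=
  U ∈ Matrix.unitaryGroup (Bits (n + 1)) ℂ ∧ p ∈ Set.Icc (0 : ℝ) 1 ∧
    ∃ φ₀ φ₁ : EuclideanSpace ℂ (Bits n), ‖φ₀‖ = 1 ∧ ‖φ₁‖ = 1 ∧
      U *ᵥ ket 0 =
        (Real.sqrt p : ℂ) • ketTensor 0 φ₀ + (Real.sqrt (1 - p) : ℂ) • ketTensor 1 φ₁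

/-- The probability of the event `E` for a uniformly random `l`-bit string. -/
noncomputable def randProb (l : ℕ) (E : Bits l → Prop) : ℝ :=
  open Classical in
  ((Finset.univ.filter E).card : ℝ) / 2 ^ l

/-- The average of `g` over a uniformly random `l`-bit string. -/
noncomputable def randMean (l : ℕ) (g : Bits l → ℝ) : ℝ := (∑ s : Bits l, g s) / 2 ^ l

end QAmp

namespace QAmp

/-! Plain amplitude estimation returns a number near `p`, but not the same number in every run.
Rounding to a grid of mesh `2^-a ≤ δ` makes the runs agree unless `p` is near a rounding boundary,
and the random string shifts the grid to move the boundaries away from `p`. The `2^l` shifts are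
multiples of `2^-(a+l)`. An estimate with error below `2^-(a+l+1)`, half a fine step, is therefore
rounded differently from `p` for at most one shift, and that shift depends only on `p`
(`exists_gridIndex_eq`, `card_filter_dvd_le_one`). The value `f s p` is the shifted rounding of `p`
itself (`shiftedRound`), so it does not refer to the oracle.

For the estimate, write `p = sin² θ`. The Grover operator rotates the plane of `|0⟩|φ₀⟩` and
`|1⟩|φ₁⟩` by `2θ` (`grover_iterate`), so `x` iterations produce the amplitudes `sin ((2x+1)θ)` and
`cos ((2x+1)θ)`. A Fourier transform over `x < M = 2^t` turns them into `waveAmp`. Its squared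
moduli add up to the average of the phase estimation distributions for `exp (±2iθ)`
(`norm_sq_waveAmp_add`), so no eigenvectors of the Grover operator are needed. The weight of the
outcomes that are off by `η` is at most `64/(Mη)` (`sum_norm_sq_phaseAmp_filter_le`), by comparison
with a damped geometric series and Parseval's identity. With `t = a + 2l + 7` this is `2^-l ≤ ε/2`.

The rounding is a brute-force lookup table on the `l + t` input and phase qubits. This is affordable
because `2^t` is `O(δ⁻¹ ε⁻²)`, and its cost does not involve `n`. Only a lower bound for the
probability of one output is needed, so amplitudes are followed only on basis labels whose ancillas
are `0` (`Represents`, `le_outProb_estimation`). -/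

/-- The state that a circuit produces from the state `ψ`. -/
def applySteps {n w : ℕ} (U : Matrix (Bits (n + 1)) (Bits (n + 1)) ℂ) (G : List (Step n w))
    (ψ : Bits w → ℂ) : Bits w → ℂ := runSteps U G *ᵥ ψ

/-! ### Circuits acting on states -/

section Basic

variable {n w : ℕ} (U : Matrix (Bits (n + 1)) (Bits (n + 1)) ℂ)

@[simp] lemma applySteps_nil (ψ : Bits w → ℂ) : applySteps U ([] : List (Step n w)) ψ = ψ := by
  simp [applySteps, runSteps]

lemma applySteps_cons (g : Step n w) (G : List (Step n w)) (ψ : Bits w → ℂ) :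
    applySteps U (g :: G) ψ = applySteps U G (g.toMatrix U *ᵥ ψ) := by
  simp [applySteps, runSteps]

lemma applySteps_append (G H : List (Step n w)) (ψ : Bits w → ℂ) :
    applySteps U (G ++ H) ψ = applySteps U H (applySteps U G ψ) := by
  induction G generalizing ψ with
  | nil => simp
  | cons g G ih => simp [applySteps_cons, ih]

lemma applySteps_singleton (g : Step n w) (ψ : Bits w → ℂ) :
    applySteps U [g] ψ = g.toMatrix U *ᵥ ψ := by
  simp [applySteps_cons]

/-- Row `x` of `onWires e M` is supported on the labels that agree with `x` off the range of `e`;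
`Function.extend` parametrizes these by the contents of the touched wires. -/
lemma onWires_mulVec {k : ℕ} (e : Fin k ↪ Fin w) (M : Matrix (Bits k) (Bits k) ℂ)
    (ψ : Bits w → ℂ) (x : Bits w) :
    (onWires e M *ᵥ ψ) x = ∑ z : Bits k, M (x ∘ e) z * ψ (Function.extend e z x) := by
  classical
  simp only [Matrix.mulVec, dotProduct, onWires, ite_mul, zero_mul]
  rw [← Finset.sum_filter]
  refine Finset.sum_nbij' (fun y => y ∘ e) (fun z => Function.extend e z x) ?_ ?_ ?_ ?_ ?_
  · simp
  · intro z _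
    simp only [Finset.mem_filter, Finset.mem_univ, true_and]
    intro j hj
    rw [Function.extend_apply' _ _ _ (by simpa using hj)]
  · intro y hy
    simp only [Finset.mem_filter, Finset.mem_univ, true_and] at hy
    funext j
    by_cases hj : j ∈ Set.range e
    · obtain ⟨i, rfl⟩ := hj
      simp [e.injective.extend_apply]
    · rw [Function.extend_apply' _ _ _ (by simpa using hj), hy j hj]
  · intro z _
    funext i
    simp [e.injective.extend_apply]
  · intro y hy
    simp only [Finset.mem_filter, Finset.mem_univ, true_and] at hy
    congr 2
    funext j
    by_cases hj : j ∈ Set.range e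
    · obtain ⟨i, rfl⟩ := hj
      simp [e.injective.extend_apply]
    · rw [Function.extend_apply' _ _ _ (by simpa using hj), hy j hj]

end Basic

/-! ### Elementary unitary matrices -/

section Unitaries

/-- The diagonal unitary with the given phases. -/
noncomputable def diagUnitary {k : ℕ} (d : Bits k → Circle) : Matrix.unitaryGroup (Bits k) ℂ :=
  ⟨Matrix.diagonal (fun x => (d x : ℂ)), by
    rw [Matrix.mem_unitaryGroup_iff, Matrix.star_eq_conjTranspose, Matrix.diagonal_conjTranspose,
      Matrix.diagonal_mul_diagonal, ← Matrix.diagonal_one]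
    congr 1
    funext x
    simp [Complex.mul_conj]⟩

/-- The unitary that permutes the computational basis. -/
noncomputable def permUnitary {k : ℕ} (f : Equiv.Perm (Bits k)) :
    Matrix.unitaryGroup (Bits k) ℂ :=
  ⟨Matrix.of fun x y => if y = f x then 1 else 0, by
    rw [Matrix.mem_unitaryGroup_iff]
    ext x y
    simp [Matrix.mul_apply, Matrix.star_eq_conjTranspose, Matrix.one_apply, eq_comm]⟩

/-- The Hadamard gate. -/
noncomputable def hadamard : Matrix.unitaryGroup (Bits 1) ℂ :=
  ⟨Matrix.of fun x y => ((Real.sqrt 2 : ℝ) : ℂ)⁻¹ * (-1) ^ ((x 0 : ℕ) * (y 0 : ℕ)), by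
    have h2 : ((Real.sqrt 2 : ℝ) : ℂ) * (Real.sqrt 2 : ℝ) = 2 := by
      rw [← Complex.ofReal_mul]; norm_num
    have h0 : ((Real.sqrt 2 : ℝ) : ℂ) ≠ 0 := by
      intro h; rw [h] at h2; norm_num at h2
    rw [Matrix.mem_unitaryGroup_iff]
    ext x y
    rw [Matrix.mul_apply, ← (Equiv.funUnique (Fin 1) (Fin 2)).symm.sum_comp]
    obtain ⟨a, rfl⟩ := (Equiv.funUnique (Fin 1) (Fin 2)).symm.surjective x
    obtain ⟨b, rfl⟩ := (Equiv.funUnique (Fin 1) (Fin 2)).symm.surjective y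
    fin_cases a <;> fin_cases b <;>
      simp [funext_iff, Fin.sum_univ_two] <;>
      field_simp <;> linear_combination -h2⟩

end Unitaries

/-! ### One- and two-qubit gates and the Toffoli gate -/

section Gates

variable {n w : ℕ}

/-- A one-qubit gate on the wire `a`. -/
noncomputable def gate₁ (n : ℕ) (V : Matrix.unitaryGroup (Bits 1) ℂ) (a : Fin w) :
    List (Step n w) :=
  [.gateOne V ⟨fun _ => a, fun _ _ _ => Subsingleton.elim _ _⟩]

/-- A two-qubit gate on the wires `a` and `b`, which have to be different. -/
noncomputable def gate₂ (n : ℕ) (V : Matrix.unitaryGroup (Bits 2) ℂ) (a b : Fin w) :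
    List (Step n w) :=
  -- Coinciding wires give the empty circuit; every statement about the action assumes `a ≠ b`.
  if h : a ≠ b then [.gateTwo V ⟨![a, b], by
    intro i j; fin_cases i <;> fin_cases j <;> simp [h, Ne.symm h]⟩] else []

variable (U : Matrix (Bits (n + 1)) (Bits (n + 1)) ℂ)

lemma applySteps_gate₁ (V : Matrix.unitaryGroup (Bits 1) ℂ) (a : Fin w) (ψ : Bits w → ℂ)
    (z : Bits w) :
    applySteps U (gate₁ n V a) ψ z =
      ∑ b : Fin 2, (V : Matrix (Bits 1) (Bits 1) ℂ) (fun _ => z a) (fun _ => b) *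
        ψ (Function.update z a b) := by
  rw [gate₁, applySteps_singleton, Step.toMatrix, onWires_mulVec,
    ← (Equiv.funUnique (Fin 1) (Fin 2)).symm.sum_comp]
  refine Finset.sum_congr rfl fun b _ => ?_
  congr 2
  funext j
  by_cases hj : j = a
  · subst hj
    rw [Function.update_self]
    exact Function.Injective.extend_apply
      (f := fun _ : Fin 1 => j) (fun _ _ _ => Subsingleton.elim _ _) _ _ 0
  · rw [Function.update_of_ne hj, Function.extend_apply']
    rintro ⟨i, hi⟩
    exact hj hi.symm

lemma extend_pair {a b : Fin w} (h : a ≠ b) (x : Bits 2) (z : Bits w) :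
    Function.extend ![a, b] x z = Function.update (Function.update z a (x 0)) b (x 1) := by
  have hinj : Function.Injective ![a, b] := by
    intro i j; fin_cases i <;> fin_cases j <;> simp [h, Ne.symm h]
  funext j
  by_cases hb : j = b
  · subst hb
    rw [Function.update_self]
    exact hinj.extend_apply x z 1
  · rw [Function.update_of_ne hb]
    by_cases ha : j = a
    · subst ha
      rw [Function.update_self]
      exact hinj.extend_apply x z 0
    · rw [Function.update_of_ne ha, Function.extend_apply']
      rintro ⟨i, hi⟩
      fin_cases i
      · exact ha hi.symm
      · exact hb hi.symm

lemma applySteps_gate₂ (V : Matrix.unitaryGroup (Bits 2) ℂ) {a b : Fin w} (h : a ≠ b)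
    (ψ : Bits w → ℂ) (z : Bits w) :
    applySteps U (gate₂ n V a b) ψ z =
      ∑ x : Bits 2, (V : Matrix (Bits 2) (Bits 2) ℂ) ![z a, z b] x *
        ψ (Function.update (Function.update z a (x 0)) b (x 1)) := by
  rw [gate₂, dif_pos h, applySteps_singleton, Step.toMatrix, onWires_mulVec]
  refine Finset.sum_congr rfl fun x _ => ?_
  congr 2
  · have : z ∘ ![a, b] = ![z a, z b] := by funext i; fin_cases i <;> rfl
    exact congrArg (fun y => (V : Matrix (Bits 2) (Bits 2) ℂ) y x) this
  · exact extend_pair h x z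

/-- A diagonal gate on two wires. -/
noncomputable def phaseGate (n : ℕ) (d : Fin 2 → Fin 2 → Circle) (a b : Fin w) :
    List (Step n w) :=
  gate₂ n (diagUnitary fun x => d (x 0) (x 1)) a b

lemma applySteps_phaseGate (d : Fin 2 → Fin 2 → Circle) {a b : Fin w} (h : a ≠ b)
    (ψ : Bits w → ℂ) (z : Bits w) :
    applySteps U (phaseGate n d a b) ψ z = d (z a) (z b) * ψ z := by
  rw [phaseGate, applySteps_gate₂ U _ h, Finset.sum_eq_single ![z a, z b]]
  · simp [diagUnitary]
  · intro x _ hx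
    simp [diagUnitary, Matrix.diagonal_apply_ne' _ hx]
  · simp

/-- The permutation of two bits that flips the second one if the first one is `α`. -/
def flipPerm (α : Fin 2) : Equiv.Perm (Bits 2) :=
  Function.Involutive.toPerm (fun x => if x 0 = α then ![x 0, x 1 + 1] else x) (by
    intro x
    by_cases h : x 0 = α
    · simp only [h, if_true]
      funext i
      fin_cases i
      · simp [h]
      · simp [add_assoc]
    · simp [h])

lemma flipPerm_apply (α : Fin 2) (x : Bits 2) :
    flipPerm α x = if x 0 = α then ![x 0, x 1 + 1] else x := rfl

/-- The gate that flips the wire `b` if the wire `a` has the value `α`. -/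
noncomputable def flipGate (n : ℕ) (a : Fin w) (α : Fin 2) (b : Fin w) : List (Step n w) :=
  gate₂ n (permUnitary (flipPerm α)) a b

/-- A permutation gate pulls the state back: the new amplitude at `z` is the old one at the permuted
label. As `flipPerm` is an involution, its direction does not matter. -/
lemma applySteps_flipGate {a b : Fin w} (α : Fin 2) (h : a ≠ b) (ψ : Bits w → ℂ) (z : Bits w) :
    applySteps U (flipGate n a α b) ψ z =
      ψ (if z a = α then Function.update z b (z b + 1) else z) := by
  rw [flipGate, applySteps_gate₂ U _ h, Finset.sum_eq_single (flipPerm α ![z a, z b])]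
  · simp only [permUnitary, Matrix.of_apply, if_true, one_mul]
    congr 1
    by_cases hz : z a = α
    · have : flipPerm α ![z a, z b] = ![z a, z b + 1] := by
        simp [flipPerm_apply, hz]
      rw [this, if_pos hz]
      simp
    · have : flipPerm α ![z a, z b] = ![z a, z b] := by
        simp [flipPerm_apply, hz]
      rw [this]
      simp [hz]
  · intro x _ hx
    simp [permUnitary, hx]
  · simp

lemma applySteps_hadamard (a : Fin w) (ψ : Bits w → ℂ) (z : Bits w) :
    applySteps U (gate₁ n hadamard a) ψ z =
      ∑ b : Fin 2, ((Real.sqrt 2 : ℝ) : ℂ)⁻¹ * (-1) ^ ((z a : ℕ) * (b : ℕ)) *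
        ψ (Function.update z a b) := by
  rw [applySteps_gate₁]
  rfl

/-- The phase `i`. -/
noncomputable def circleI : Circle := ⟨Complex.I, by simp [Submonoid.unitSphere]⟩

lemma coe_circleI : (circleI : ℂ) = Complex.I := rfl

/-- The gate that flips the wire `c` if the wires `a` and `b` have the values `α` and `β`. -/
noncomputable def toffoli (n : ℕ) (a : Fin w) (α : Fin 2) (b : Fin w) (β : Fin 2) (c : Fin w) :
    List (Step n w) :=
  gate₁ n hadamard c ++
    (phaseGate n (fun x y => if x = β ∧ y = 1 then circleI else 1) b c ++
    (flipGate n a α b ++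
    (phaseGate n (fun x y => if x = β ∧ y = 1 then circleI⁻¹ else 1) b c ++
    (flipGate n a α b ++
    (phaseGate n (fun x y => if x = α ∧ y = 1 then circleI else 1) a c ++
    gate₁ n hadamard c)))))

/-- Let `A` and `B` be the truth values of `z a = α` and `z b = β`. The gates between the Hadamards
multiply by `i` to the power `z c * (B - (A xor B) + A) = 2 * A * B * z c`. This is a doubly
controlled sign, and conjugation by Hadamards turns it into a flip of `c`. -/
lemma applySteps_toffoli {a b c : Fin w} (α β : Fin 2) (hab : a ≠ b) (hac : a ≠ c) (hbc : b ≠ c)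
    (ψ : Bits w → ℂ) (z : Bits w) :
    applySteps U (toffoli n a α b β c) ψ z =
      ψ (if z a = α ∧ z b = β then Function.update z c (z c + 1) else z) := by
  have h2 : ((Real.sqrt 2 : ℝ) : ℂ)⁻¹ * ((Real.sqrt 2 : ℝ) : ℂ)⁻¹ = 2⁻¹ := by
    rw [← mul_inv, ← Complex.ofReal_mul]; norm_num
  have key : ∀ (φ : Bits w → ℂ) (z : Bits w), applySteps U
      (phaseGate n (fun x y => if x = β ∧ y = 1 then circleI else 1) b c ++
      (flipGate n a α b ++
      (phaseGate n (fun x y => if x = β ∧ y = 1 then circleI⁻¹ else 1) b c ++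
      (flipGate n a α b ++
      (phaseGate n (fun x y => if x = α ∧ y = 1 then circleI else 1) a c))))) φ z =
      (if z a = α ∧ z b = β ∧ z c = 1 then -1 else 1) * φ z := by
    intro φ z
    simp only [applySteps_append]
    rw [applySteps_phaseGate U _ hac, applySteps_flipGate U _ hab, applySteps_phaseGate U _ hbc,
      applySteps_flipGate U _ hab, applySteps_phaseGate U _ hbc]
    have hb2 : ∀ b β : Fin 2, (b + 1 = β) ↔ ¬ (b = β) := by decide
    have hub : z b = β → Function.update z b β = z := by
      rintro rfl; exact Function.update_eq_self b z
    have h11 : ∀ b : Fin 2, b + 1 + 1 = b := by decide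
    by_cases ha : z a = α <;> by_cases hb : z b = β <;> by_cases hc : z c = 1 <;>
      simp [ha, hb, hc, hab, hbc.symm, hb2, coe_circleI,
        Function.update_of_ne, h11]
    all_goals
      try rw [hub hb]
      try rw [← mul_assoc, Complex.I_mul_I]
      try simp
  have hassoc : toffoli n a α b β c = gate₁ n hadamard c ++
      ((phaseGate n (fun x y => if x = β ∧ y = 1 then circleI else 1) b c ++
      (flipGate n a α b ++
      (phaseGate n (fun x y => if x = β ∧ y = 1 then circleI⁻¹ else 1) b c ++
      (flipGate n a α b ++
      (phaseGate n (fun x y => if x = α ∧ y = 1 then circleI else 1) a c))))) ++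
      gate₁ n hadamard c) := by
    simp [toffoli, List.append_assoc]
  rw [hassoc, applySteps_append, applySteps_append, applySteps_hadamard]
  simp only [key, applySteps_hadamard]
  have hz0 : ∀ b : Fin 2, b = z c → Function.update z c b = z := by
    rintro b rfl; simp
  have hcase : z c = 0 ∨ z c = 1 := by
    generalize z c = v; revert v; decide
  by_cases ha : z a = α <;> by_cases hb : z b = β <;> rcases hcase with hc | hc <;>
    simp [ha, hb, hc, hac, hbc, Fin.sum_univ_two, hz0]
  all_goals
    try rw [hz0 _ hc.symm]
    first
      | linear_combination (2 * ψ z) * h2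
      | linear_combination (2 * ψ (Function.update z c 0)) * h2
      | linear_combination (2 * ψ (Function.update z c 1)) * h2

end Gates

/-! ### Flips with many controls -/

section MultiFlip

variable {n w : ℕ}

/-- The circuit that flips the wire `tgt` if the wire `c` has the value `γ` and, for all `p` in the
list, the wire `p.1` has the value `p.2`. It uses ancillas that are initially `0`. -/
noncomputable def multiFlip (n : ℕ) :
    Fin w → Fin 2 → List (Fin w × Fin 2) → List (Fin w) → Fin w → List (Step n w)
  | c, γ, [], _, tgt => flipGate n c γ tgt
  | _, _, _ :: _, [], _ => []
  | c, γ, p :: ps, a :: as, tgt =>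
    toffoli n c γ p.1 p.2 a ++ (multiFlip n a 1 ps as tgt ++ toffoli n c γ p.1 p.2 a)

variable (U : Matrix (Bits (n + 1)) (Bits (n + 1)) ℂ)

/-- A Toffoli gate stores the conjunction of two conditions in a fresh ancilla, which becomes the
first control of the remaining problem; repeating that Toffoli at the end restores the ancilla. -/
lemma applySteps_multiFlip (c : Fin w) (γ : Fin 2) (ps : List (Fin w × Fin 2))
    (as : List (Fin w)) (tgt : Fin w) (ψ : Bits w → ℂ) (z : Bits w)
    (hlen : ps.length ≤ as.length) (hnd : as.Nodup) (hz : ∀ a ∈ as, z a = 0) (hca : c ∉ as)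
    (hta : tgt ∉ as) (hct : c ≠ tgt) (hps : ∀ p ∈ ps, p.1 ∉ as ∧ p.1 ≠ c ∧ p.1 ≠ tgt) :
    applySteps U (multiFlip n c γ ps as tgt) ψ z =
      ψ (if z c = γ ∧ ∀ p ∈ ps, z p.1 = p.2 then Function.update z tgt (z tgt + 1) else z) := by
  induction ps generalizing c γ as z ψ with
  | nil => simp [multiFlip, applySteps_flipGate U γ hct]
  | cons p ps ih =>
    cases as with
    | nil => simp at hlen
    | cons a as =>
      obtain ⟨hp, hps⟩ := List.forall_mem_cons.1 hps
      obtain ⟨hza, hz⟩ := List.forall_mem_cons.1 hz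
      obtain ⟨haas, hnd⟩ := List.nodup_cons.1 hnd
      simp only [List.mem_cons, not_or] at hca hta hp
      have htof := fun ψ z => applySteps_toffoli U (a := c) (b := p.1) (c := a) γ p.2
        (Ne.symm hp.2.1) hca.1 hp.1.1 ψ z
      have h11 : ∀ b : Fin 2, b + 1 + 1 = b := by decide
      -- The amplitude at `z` is traced backwards: the last Toffoli is evaluated first, then the
      -- inner flip, then the first Toffoli.
      rw [multiFlip, applySteps_append, applySteps_append, htof, ih]
      · rw [htof]
        congr 1
        have hrest : ∀ v, (∀ q ∈ ps, Function.update z a v q.1 = q.2) ↔ ∀ q ∈ ps, z q.1 = q.2 :=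
          fun v => forall₂_congr fun q hq => by
            have := (hps q hq).1
            simp only [List.mem_cons, not_or] at this
            rw [Function.update_of_ne this.1]
        by_cases h : z c = γ ∧ z p.1 = p.2
        · rw [if_pos h]
          by_cases h' : ∀ q ∈ ps, z q.1 = q.2
          · have h2 : z c = γ ∧ ∀ q ∈ p :: ps, z q.1 = q.2 :=
              ⟨h.1, List.forall_mem_cons.2 ⟨h.2, h'⟩⟩
            have h3 : Function.update z a (z a + 1) a = 1 ∧
                ∀ q ∈ ps, Function.update z a (z a + 1) q.1 = q.2 :=
              ⟨by simp [hza], (hrest _).2 h'⟩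
            rw [if_pos h3, if_pos h2, if_pos]
            · funext j
              by_cases hja : j = a
              · subst hja
                simp [Ne.symm hta.1, h11]
              · by_cases hjt : j = tgt <;> simp [hja, hjt, hta.1]
            · simp [hct, hp.2.2, hca.1, hp.1.1, h]
          · have h2 : ¬ (z c = γ ∧ ∀ q ∈ p :: ps, z q.1 = q.2) := fun H =>
              h' (List.forall_mem_cons.1 H.2).2
            have h3 : ¬ (Function.update z a (z a + 1) a = 1 ∧
                ∀ q ∈ ps, Function.update z a (z a + 1) q.1 = q.2) := fun H =>
              h' ((hrest _).1 H.2)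
            rw [if_neg h3, if_neg h2, if_pos]
            · simp [h11]
            · simp [hca.1, hp.1.1, h]
        · have h2 : ¬ (z c = γ ∧ ∀ q ∈ p :: ps, z q.1 = q.2) := fun H =>
            h ⟨H.1, (List.forall_mem_cons.1 H.2).1⟩
          have h3 : ¬ (z a = 1 ∧ ∀ q ∈ ps, z q.1 = q.2) := fun H => by simp [hza] at H
          rw [if_neg h, if_neg h3, if_neg h, if_neg h2]
      · simpa using hlen
      · exact hnd
      · intro b hb
        have : b ≠ a := fun h => haas (h ▸ hb)
        split_ifs
        · rw [Function.update_of_ne this, hz b hb]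
        · exact hz b hb
      · exact haas
      · exact hta.2
      · exact Ne.symm hta.1
      · intro q hq
        have := hps q hq
        simp only [List.mem_cons, not_or] at this
        exact ⟨this.1.2, this.1.1, this.2.2⟩

end MultiFlip

/-! ### Binary expansions in both bit orders -/

section Values

/-- The natural number with the given binary digits, the most significant digit first. -/
def bigVal : {m : ℕ} → Bits m → ℕ
  | 0, _ => 0
  | m + 1, x => (x 0 : ℕ) * 2 ^ m + bigVal (fun i : Fin m => x i.succ)

/-- The natural number with the given binary digits, the least significant digit first. -/
def littleVal : {m : ℕ} → Bits m → ℕ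
  | 0, _ => 0
  | m + 1, x => (x 0 : ℕ) + 2 * littleVal (fun i : Fin m => x i.succ)

lemma sum_bits_succ {M : Type*} [AddCommMonoid M] {m : ℕ} (F : Bits (m + 1) → M) :
    ∑ x, F x = ∑ b : Fin 2, ∑ x : Bits m, F (Fin.cons b x) := by
  rw [← (Fin.consEquiv fun _ : Fin (m + 1) => Fin 2).sum_comp, Fintype.sum_prod_type]
  rfl

lemma sum_bigVal {M : Type*} [AddCommMonoid M] (m : ℕ) (F : ℕ → M) :
    ∑ x : Bits m, F (bigVal x) = ∑ k ∈ Finset.range (2 ^ m), F k := by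
  induction m generalizing F with
  | zero => simp [bigVal]
  | succ m ih =>
    rw [sum_bits_succ, Fin.sum_univ_two, pow_succ, mul_two, Finset.sum_range_add]
    simp only [bigVal, Fin.cons_zero, Fin.cons_succ, Fin.val_zero, Fin.val_one, zero_mul, zero_add,
      one_mul]
    rw [ih F, ih fun k => F (2 ^ m + k)]

lemma sum_littleVal {M : Type*} [AddCommMonoid M] (m : ℕ) (F : ℕ → M) :
    ∑ x : Bits m, F (littleVal x) = ∑ k ∈ Finset.range (2 ^ m), F k := by
  have htwo : ∀ (F : ℕ → M) (N : ℕ), ∑ k ∈ Finset.range (2 * N), F k =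
      ∑ k ∈ Finset.range N, F (0 + 2 * k) + ∑ k ∈ Finset.range N, F (1 + 2 * k) := by
    intro F N
    induction N with
    | zero => simp
    | succ N ih =>
      rw [mul_add, mul_one, Finset.sum_range_succ, Finset.sum_range_succ, ih,
        Finset.sum_range_succ, Finset.sum_range_succ, zero_add, add_comm 1 (2 * N)]
      abel
  induction m generalizing F with
  | zero => simp [littleVal]
  | succ m ih =>
    rw [sum_bits_succ, Fin.sum_univ_two, pow_succ, mul_comm, htwo]
    simp only [littleVal, Fin.cons_zero, Fin.cons_succ, Fin.val_zero, Fin.val_one]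
    rw [ih fun k => F (0 + 2 * k), ih fun k => F (1 + 2 * k)]

lemma bigVal_lt {m : ℕ} (x : Bits m) : bigVal x < 2 ^ m := by
  induction m with
  | zero => simp [bigVal]
  | succ m ih =>
    have := ih fun i => x i.succ
    have h0 : (x 0 : ℕ) ≤ 1 := by omega
    have h1 : (x 0 : ℕ) * 2 ^ m ≤ 1 * 2 ^ m := Nat.mul_le_mul_right _ h0
    rw [bigVal, pow_succ]
    omega

/-- Applied to the indicator of `k`, `sum_bigVal` counts the strings of value `k`: exactly one when
`k < 2 ^ m`. Injectivity below follows from the same count. -/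
lemma exists_bigVal_eq {m k : ℕ} (hk : k < 2 ^ m) : ∃ x : Bits m, bigVal x = k := by
  classical
  by_contra! h
  have := sum_bigVal m fun j => if j = k then 1 else 0
  simp [h, hk] at this

lemma bigVal_injective (m : ℕ) : Function.Injective (bigVal (m := m)) := by
  classical
  intro x y hxy
  have h := sum_bigVal m fun j => if j = bigVal y then 1 else 0
  rw [Finset.sum_ite_eq', if_pos (Finset.mem_range.2 (bigVal_lt y)), Finset.sum_boole] at h
  have hc : (Finset.univ.filter fun x : Bits m => bigVal x = bigVal y).card ≤ 1 := by
    simpa using h.le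
  exact Finset.card_le_one.1 hc x (by simp [hxy]) y (by simp)

lemma bigVal_eq_sum {m : ℕ} (x : Bits m) :
    (bigVal x : ℝ) / 2 ^ m = ∑ i : Fin m, ((x i : ℕ) : ℝ) / 2 ^ ((i : ℕ) + 1) := by
  induction m with
  | zero => simp [bigVal]
  | succ m ih =>
    have h := ih fun i => x i.succ
    rw [Fin.sum_univ_succ]
    have h2 : ∑ i : Fin m, ((x i.succ : ℕ) : ℝ) / 2 ^ ((i.succ : ℕ) + 1) =
        (∑ i : Fin m, ((x i.succ : ℕ) : ℝ) / 2 ^ ((i : ℕ) + 1)) / 2 := by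
      rw [Finset.sum_div]
      refine Finset.sum_congr rfl fun i _ => ?_
      rw [Fin.val_succ, pow_succ, ← div_div]
    rw [h2, ← h, bigVal]
    push_cast
    simp only [Fin.val_zero, zero_add, pow_one]
    field_simp
    ring

end Values

/-! ### The Fourier transform circuit -/

section Fourier

variable {n w : ℕ}

/-- The controlled phases between the wire `q` and the wires `e i`. -/
noncomputable def phaseLadder (n : ℕ) (q : Fin w) (N : ℕ) :
    (m : ℕ) → (Fin m → Fin w) → List (Step n w)
  | 0, _ => []
  | m + 1, e =>
    phaseGate n (fun x y => Circle.exp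
      (-(2 * Real.pi * ((x : ℕ) : ℝ) * ((y : ℕ) : ℝ) * 2 ^ m / N))) q (e 0) ++
      phaseLadder n q N m (fun i => e i.succ)

/-- The inverse Fourier transform on the wires `e i`; the order of the bits is reversed. -/
noncomputable def fourier (n : ℕ) : (m : ℕ) → (Fin m → Fin w) → List (Step n w)
  | 0, _ => []
  | m + 1, e =>
    gate₁ n hadamard (e 0) ++ (phaseLadder n (e 0) (2 ^ (m + 1)) m (fun i => e i.succ) ++
      fourier n m (fun i => e i.succ))

variable (U : Matrix (Bits (n + 1)) (Bits (n + 1)) ℂ)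

lemma applySteps_phaseLadder (q : Fin w) (N : ℕ) {m : ℕ} (e : Fin m → Fin w)
    (hq : ∀ i, q ≠ e i) (ψ : Bits w → ℂ) (z : Bits w) :
    applySteps U (phaseLadder n q N m e) ψ z =
      Complex.exp (-(2 * Real.pi * Complex.I * (z q : ℕ) * bigVal (z ∘ e) / N)) * ψ z := by
  induction m generalizing ψ with
  | zero => simp [phaseLadder, bigVal]
  | succ m ih =>
    rw [phaseLadder, applySteps_append, ih _ (fun i => hq _), applySteps_phaseGate U _ (hq 0),
      ← mul_assoc, Circle.coe_exp, ← Complex.exp_add]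
    congr 2
    rw [bigVal]
    simp only [Function.comp_def]
    push_cast
    ring

lemma extend_cons {m : ℕ} {e : Fin (m + 1) → Fin w} (he : Function.Injective e) (b : Fin 2)
    (x : Bits m) (z : Bits w) :
    Function.extend e (Fin.cons b x : Bits (m + 1)) z =
      Function.update (Function.extend (fun i => e i.succ) x z) (e 0) b := by
  have he' : Function.Injective fun i : Fin m => e i.succ :=
    he.comp (Fin.succ_injective m)
  funext j
  by_cases hj : ∃ i, e i = j
  · obtain ⟨i, rfl⟩ := hj
    rw [he.extend_apply]
    refine Fin.cases ?_ (fun i => ?_) i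
    · simp
    · rw [Function.update_of_ne (he.ne (Fin.succ_ne_zero i)), he'.extend_apply]
      simp
  · rw [Function.extend_apply' _ _ _ hj, Function.update_of_ne (fun h => hj ⟨0, h.symm⟩),
      Function.extend_apply' _ _ _ (fun ⟨i, hi⟩ => hj ⟨_, hi⟩)]

/-- The entries of the inverse Fourier transform. -/
noncomputable def fourierKernel {m : ℕ} (x y : Bits m) : ℂ :=
  ((Real.sqrt 2 : ℝ) : ℂ)⁻¹ ^ m *
    Complex.exp (-(2 * Real.pi * Complex.I * bigVal x * littleVal y / 2 ^ m))

/-- With `x = b * 2^m + x'` and `y = y₀ + 2 * y'`, the fraction `x * y / 2^(m+1)` equals `x' * y' /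
2^m + y₀ * x' / 2^(m+1) + b * y₀ / 2 + b * y'`. The four terms are the smaller transform, the phase
ladder, the Hadamard gate, and an integer that drops out of the exponential. -/
lemma fourierKernel_cons {m : ℕ} (b : Fin 2) (x : Bits m) (y : Bits (m + 1)) :
    fourierKernel (Fin.cons b x : Bits (m + 1)) y =
      fourierKernel x (fun i => y i.succ) *
        (Complex.exp (-(2 * Real.pi * Complex.I * (y 0 : ℕ) * bigVal x / (2 ^ (m + 1) : ℕ))) *
          (((Real.sqrt 2 : ℝ) : ℂ)⁻¹ * (-1) ^ ((y 0 : ℕ) * (b : ℕ)))) := by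
  have h1 : (-1 : ℂ) ^ ((y 0 : ℕ) * (b : ℕ)) =
      Complex.exp (((y 0 : ℕ) * (b : ℕ) : ℕ) * -(Real.pi * Complex.I)) := by
    rw [Complex.exp_nat_mul, Complex.exp_neg, Complex.exp_pi_mul_I]
    norm_num
  have h2 : Complex.exp (((b : ℕ) * littleVal (fun i => y i.succ) : ℕ) *
      -(2 * Real.pi * Complex.I)) = 1 := by
    rw [Complex.exp_nat_mul, Complex.exp_neg, Complex.exp_two_pi_mul_I]
    simp
  rw [h1, fourierKernel, fourierKernel]
  have h3 : -(2 * Real.pi * Complex.I * bigVal (Fin.cons b x : Bits (m + 1)) * littleVal y /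
      2 ^ (m + 1)) = -(2 * Real.pi * Complex.I * bigVal x * littleVal (fun i => y i.succ) / 2 ^ m) +
      (-(2 * Real.pi * Complex.I * (y 0 : ℕ) * bigVal x / (2 ^ (m + 1) : ℕ)) +
      (((y 0 : ℕ) * (b : ℕ) : ℕ) * -(Real.pi * Complex.I) +
      ((b : ℕ) * littleVal (fun i => y i.succ) : ℕ) * -(2 * Real.pi * Complex.I))) := by
    simp only [bigVal, littleVal, Fin.cons_zero, Fin.cons_succ]
    push_cast
    field_simp
    ring
  rw [h3, Complex.exp_add, Complex.exp_add, Complex.exp_add, h2]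
  ring

lemma applySteps_fourier {m : ℕ} (e : Fin m → Fin w) (he : Function.Injective e)
    (ψ : Bits w → ℂ) (z : Bits w) :
    applySteps U (fourier n m e) ψ z =
      ∑ x : Bits m, fourierKernel x (z ∘ e) * ψ (Function.extend e x z) := by
  induction m generalizing ψ with
  | zero =>
    have : ∀ x : Bits 0, Function.extend e x z = z := fun x => by
      funext j; rw [Function.extend_apply']; rintro ⟨i, -⟩; exact i.elim0
    simp [fourier, fourierKernel, this, bigVal]
  | succ m ih =>
    have he' : Function.Injective fun i : Fin m => e i.succ := he.comp (Fin.succ_injective m)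
    have h0 : ∀ i : Fin m, e 0 ≠ e i.succ := fun i => he.ne (Fin.succ_ne_zero i).symm
    rw [fourier, applySteps_append, applySteps_append, ih _ he', sum_bits_succ, Finset.sum_comm]
    refine Finset.sum_congr rfl fun x _ => ?_
    rw [applySteps_phaseLadder U _ _ _ h0, applySteps_hadamard, Finset.mul_sum, Finset.mul_sum]
    refine Finset.sum_congr rfl fun b _ => ?_
    have hz0 : Function.extend (fun i : Fin m => e i.succ) x z (e 0) = z (e 0) :=
      Function.extend_apply' _ _ _ fun ⟨i, hi⟩ => h0 i hi.symm
    have hzx : Function.extend (fun i : Fin m => e i.succ) x z ∘ (fun i => e i.succ) = x :=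
      funext fun i => he'.extend_apply x z i
    rw [hz0, hzx, fourierKernel_cons, extend_cons he]
    simp only [Function.comp_def]
    ring

end Fourier

/-! ### Evolution of the phase and oracle registers, all other wires fixed -/

section Registers

variable {n w t : ℕ}

/-- The label `z` agrees with `base` outside of the registers `P` and `Y`. -/
def AgreesOff (P : Fin t ↪ Fin w) (Y : Fin (n + 1) ↪ Fin w) (base z : Bits w) : Prop :=
  ∀ j, j ∉ Set.range P → j ∉ Set.range Y → z j = base j

/-- On the labels that agree with `base` outside of the registers `P` and `Y`, the state `ψ` has the
amplitudes `c`. -/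
def Represents (P : Fin t ↪ Fin w) (Y : Fin (n + 1) ↪ Fin w) (base : Bits w)
    (ψ : Bits w → ℂ) (c : Bits t → Bits (n + 1) → ℂ) : Prop :=
  ∀ z, AgreesOff P Y base z → ψ z = c (z ∘ P) (z ∘ Y)

/-- The registers `P`, `Y`, the flag wire `f` and the ancillas `as` are disjoint, and the
ancillas are initially `0`. -/
structure IsLayout (P : Fin t ↪ Fin w) (Y : Fin (n + 1) ↪ Fin w) (f : Fin w)
    (as : List (Fin w)) (base : Bits w) : Prop where
  P_ne_Y : ∀ i j, P i ≠ Y j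
  P_ne_f : ∀ i, P i ≠ f
  Y_ne_f : ∀ i, Y i ≠ f
  nodup : as.Nodup
  f_notMem : f ∉ as
  P_notMem : ∀ i, P i ∉ as
  Y_notMem : ∀ i, Y i ∉ as
  base_f : base f = 0
  base_as : ∀ a ∈ as, base a = 0
  length_le : n + 1 ≤ as.length

variable {P : Fin t ↪ Fin w} {Y : Fin (n + 1) ↪ Fin w} {f : Fin w} {as : List (Fin w)}
  {base : Bits w} (U : Matrix (Bits (n + 1)) (Bits (n + 1)) ℂ)
  {ψ : Bits w → ℂ} {c : Bits t → Bits (n + 1) → ℂ}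

lemma AgreesOff.extend {z : Bits w} (hz : AgreesOff P Y base z) {k : ℕ} {e : Fin k → Fin w}
    (he : ∀ i, e i ∈ Set.range P ∨ e i ∈ Set.range Y) (x : Bits k) :
    AgreesOff P Y base (Function.extend e x z) := by
  intro j hP hY
  rw [Function.extend_apply', hz j hP hY]
  rintro ⟨i, rfl⟩
  rcases he i with h | h
  · exact hP h
  · exact hY h

lemma IsLayout.apply_f (h : IsLayout P Y f as base) {z : Bits w} (hz : AgreesOff P Y base z) :
    z f = 0 := by
  rw [hz f, h.base_f]
  · rintro ⟨i, hi⟩; exact h.P_ne_f i hi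
  · rintro ⟨i, hi⟩; exact h.Y_ne_f i hi

lemma IsLayout.apply_as (h : IsLayout P Y f as base) {z : Bits w} (hz : AgreesOff P Y base z) :
    ∀ a ∈ as, z a = 0 := by
  intro a ha
  rw [hz a, h.base_as a ha]
  · rintro ⟨i, rfl⟩; exact h.P_notMem i ha
  · rintro ⟨i, rfl⟩; exact h.Y_notMem i ha

lemma Represents.fourier (h : IsLayout P Y f as base) (hψ : Represents P Y base ψ c) :
    Represents P Y base (applySteps U (fourier n t P) ψ)
      (fun y u => ∑ x, fourierKernel x y * c x u) := by
  intro z hz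
  rw [applySteps_fourier U P P.injective]
  refine Finset.sum_congr rfl fun x _ => ?_
  rw [hψ _ (hz.extend (fun i => .inl ⟨i, rfl⟩) x)]
  congr 2
  · funext i; exact P.injective.extend_apply x z i
  · funext i
    exact Function.extend_apply' _ _ _ fun ⟨j, hj⟩ => h.P_ne_Y j i hj

lemma Represents.onWires (h : IsLayout P Y f as base) (hψ : Represents P Y base ψ c)
    (M : Matrix (Bits (n + 1)) (Bits (n + 1)) ℂ) :
    Represents P Y base (onWires Y M *ᵥ ψ) (fun y => M *ᵥ c y) := by
  intro z hz
  rw [onWires_mulVec]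
  refine Finset.sum_congr rfl fun x _ => ?_
  rw [hψ _ (hz.extend (fun i => .inr ⟨i, rfl⟩) x)]
  congr 2
  · funext i
    exact Function.extend_apply' _ _ _ fun ⟨j, hj⟩ => h.P_ne_Y i j hj.symm
  · funext i; exact Y.injective.extend_apply x z i

/-- The list that requires the wires `I i` to have the values `q i`. -/
noncomputable def pattern {ι : Type*} [Fintype ι] (I : ι → Fin w) (q : ι → Fin 2) :
    List (Fin w × Fin 2) :=
  Finset.univ.toList.map fun i => (I i, q i)

lemma length_pattern {ι : Type*} [Fintype ι] (I : ι → Fin w) (q : ι → Fin 2) :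
    (pattern I q).length = Fintype.card ι := by
  simp [pattern]

lemma forall_mem_pattern {ι : Type*} [Fintype ι] {I : ι → Fin w} {q : ι → Fin 2}
    {p : Fin w × Fin 2 → Prop} : (∀ x ∈ pattern I q, p x) ↔ ∀ i, p (I i, q i) := by
  simp [pattern]

/-- The phase `-1` if the wire `q` is `1` and all the wires `Y i` are `0`. -/
noncomputable def reflectZeroSteps (q : Fin w) (Y : Fin (n + 1) ↪ Fin w) (f : Fin w)
    (as : List (Fin w)) : List (Step n w) :=
  multiFlip n q 1 (pattern Y 0) as f ++
    (phaseGate n (fun _ y => if y = 1 then circleI * circleI else 1) q f ++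
      multiFlip n q 1 (pattern Y 0) as f)

/-- The reflection that changes the sign of `|0⟩`. -/
def reflectZero (v : Bits (n + 1) → ℂ) : Bits (n + 1) → ℂ := fun u => if u = 0 then -v u else v u

/-- The reflection that changes the sign of the vectors `|1⟩|φ⟩`. -/
def reflectOne (v : Bits (n + 1) → ℂ) : Bits (n + 1) → ℂ := fun u => if u 0 = 1 then -v u else v u

/-- The flag records whether the control is `1` and the register is zero, receives the phase `i * i
= -1`, and is then uncomputed, so the label is back in the class that `Represents` describes. -/
lemma Represents.reflectZero (h : IsLayout P Y f as base) (hψ : Represents P Y base ψ c)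
    (i : Fin t) :
    Represents P Y base (applySteps U (reflectZeroSteps (P i) Y f as) ψ)
      (fun y => if y i = 1 then reflectZero (c y) else c y) := by
  intro z hz
  have hf := h.apply_f hz
  have has := h.apply_as hz
  have hmf : ∀ (ψ : Bits w → ℂ) (z : Bits w), (∀ a ∈ as, z a = 0) →
      applySteps U (multiFlip n (P i) 1 (pattern Y 0) as f) ψ z =
        ψ (if z (P i) = 1 ∧ z ∘ Y = 0 then Function.update z f (z f + 1) else z) := by
    intro ψ z hz
    rw [applySteps_multiFlip U _ _ _ _ _ _ _ _ h.nodup hz (h.P_notMem i) h.f_notMem (h.P_ne_f i)]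
    · simp only [forall_mem_pattern, funext_iff, Function.comp_apply]
    · rw [forall_mem_pattern]
      exact fun j => ⟨h.Y_notMem j, (h.P_ne_Y i j).symm, h.Y_ne_f j⟩
    · rw [length_pattern, Fintype.card_fin]
      exact h.length_le
  rw [reflectZeroSteps, applySteps_append, applySteps_append, hmf _ _ has,
    applySteps_phaseGate U _ (h.P_ne_f i)]
  have h11 : ∀ b : Fin 2, b + 1 + 1 = b := by decide
  by_cases hc : z (P i) = 1 ∧ z ∘ Y = 0
  · have hc' : Function.update z f (z f + 1) (P i) = 1 ∧
        Function.update z f (z f + 1) ∘ Y = 0 := by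
      constructor
      · rw [Function.update_of_ne (h.P_ne_f i), hc.1]
      · rw [← hc.2]
        funext j
        simp [h.Y_ne_f j]
    rw [if_pos hc, hmf, if_pos hc']
    · have h2 : Function.update (Function.update z f (z f + 1)) f
          (Function.update z f (z f + 1) f + 1) = z := by
        simp [h11]
      rw [h2, hψ z hz]
      simp [hf, QAmp.reflectZero, hc.1, hc.2, coe_circleI]
    · intro a ha
      have haf : a ≠ f := fun H => h.f_notMem (H ▸ ha)
      rw [Function.update_of_ne haf, has a ha]
  · rw [if_neg hc, hmf _ _ has, if_neg hc, hf, hψ z hz]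
    by_cases h1 : z (P i) = 1
    · have h2 : z ∘ Y ≠ 0 := fun H => hc ⟨h1, H⟩
      simp [h1, QAmp.reflectZero, h2]
    · simp [h1]

/-- The phase `-1` if the wires `q` and `q'` are `1`. -/
noncomputable def reflectOneSteps (n : ℕ) (q q' : Fin w) : List (Step n w) :=
  phaseGate n (fun x y => if x = 1 ∧ y = 1 then circleI * circleI else 1) q q'

lemma Represents.reflectOne (h : IsLayout P Y f as base) (hψ : Represents P Y base ψ c)
    (i : Fin t) :
    Represents P Y base (applySteps U (reflectOneSteps n (P i) (Y 0)) ψ)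
      (fun y => if y i = 1 then reflectOne (c y) else c y) := by
  intro z hz
  rw [reflectOneSteps, applySteps_phaseGate U _ (h.P_ne_Y i 0), hψ z hz]
  by_cases h1 : z (P i) = 1 <;> by_cases h2 : z (Y 0) = 1 <;>
    simp [h1, h2, QAmp.reflectOne, coe_circleI]

/-- The Grover operator of amplitude amplification. -/
def grover (v : Bits (n + 1) → ℂ) : Bits (n + 1) → ℂ :=
  U *ᵥ reflectZero (Uᴴ *ᵥ reflectOne v)

/-- The Grover operator, controlled by the wire `q`. -/
noncomputable def groverSteps (q : Fin w) (Y : Fin (n + 1) ↪ Fin w) (f : Fin w)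
    (as : List (Fin w)) : List (Step n w) :=
  reflectOneSteps n q (Y 0) ++ (.queryInv Y :: (reflectZeroSteps q Y f as ++ [.query Y]))

/-- Only the two reflections are controlled. If the control is `0`, the remaining inverse query and
query cancel by `hU`, so no controlled oracle is required. -/
lemma Represents.grover (h : IsLayout P Y f as base) (hψ : Represents P Y base ψ c)
    (hU : U * Uᴴ = 1) (i : Fin t) :
    Represents P Y base (applySteps U (groverSteps (P i) Y f as) ψ)
      (fun y => if y i = 1 then grover U (c y) else c y) := by
  rw [groverSteps, applySteps_append, applySteps_cons, applySteps_append, applySteps_singleton]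
  have := (((hψ.reflectOne U h i).onWires h Uᴴ).reflectZero U h i).onWires h U
  have hc : (fun y => if y i = 1 then QAmp.grover U (c y) else c y) = fun y => U *ᵥ
      if y i = 1 then QAmp.reflectZero (Uᴴ *ᵥ if y i = 1 then QAmp.reflectOne (c y) else c y)
      else Uᴴ *ᵥ if y i = 1 then QAmp.reflectOne (c y) else c y := by
    funext y
    by_cases hy : y i = 1
    · simp [hy, QAmp.grover]
    · simp [hy, Matrix.mulVec_mulVec, hU]
  rw [hc]
  exact this

lemma Represents.grover_replicate (h : IsLayout P Y f as base) (hψ : Represents P Y base ψ c)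
    (hU : U * Uᴴ = 1) (i : Fin t) (k : ℕ) :
    Represents P Y base
      (applySteps U (List.replicate k (groverSteps (P i) Y f as)).flatten ψ)
      (fun y => if y i = 1 then (QAmp.grover U)^[k] (c y) else c y) := by
  induction k generalizing ψ c with
  | zero => simpa using hψ
  | succ k ih =>
    rw [List.replicate_succ, List.flatten_cons, applySteps_append]
    convert ih (hψ.grover U h hU i) using 2 with y
    by_cases hy : y i = 1 <;> simp [hy]

/-- The powers of the Grover operator, the exponent being the number on the wires `e i`. -/
noncomputable def groverPowSteps (Y : Fin (n + 1) ↪ Fin w) (f : Fin w) (as : List (Fin w)) :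
    (m : ℕ) → (Fin m → Fin w) → List (Step n w)
  | 0, _ => []
  | m + 1, e => (List.replicate (2 ^ m) (groverSteps (e 0) Y f as)).flatten ++
      groverPowSteps Y f as m (fun i => e i.succ)

lemma Represents.groverPow (h : IsLayout P Y f as base) (hψ : Represents P Y base ψ c)
    (hU : U * Uᴴ = 1) {m : ℕ} (ι : Fin m → Fin t) :
    Represents P Y base (applySteps U (groverPowSteps Y f as m (fun i => P (ι i))) ψ)
      (fun y => (QAmp.grover U)^[bigVal (fun i => y (ι i))] (c y)) := by
  induction m generalizing ψ c with
  | zero => simpa [groverPowSteps, bigVal] using hψ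
  | succ m ih =>
    rw [groverPowSteps, applySteps_append]
    convert ih (hψ.grover_replicate U h hU (ι 0) (2 ^ m)) (fun i => ι i.succ) using 2 with y
    -- The block of the leading wire acts first, so its exponent has to be the inner one.
    rw [bigVal, Nat.add_comm (_ * _), Function.iterate_add_apply]
    have hy : y (ι 0) = 0 ∨ y (ι 0) = 1 := by generalize y (ι 0) = b; revert b; decide
    rcases hy with hy | hy <;> simp [hy]

end Registers

/-! ### Evaluating a classical table -/

section Lookup

variable {n w r : ℕ} {ι : Type*} [Fintype ι]

/-- The circuit that adds `g q i` to the wire `out i` for the pairs `(q, i)` in the list for which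
`q` is on the wires `I`. -/
noncomputable def lookupSteps (n : ℕ) (I : ι → Fin w) (out : Fin r → Fin w) (a₀ : Fin w)
    (as : List (Fin w)) (g : (ι → Fin 2) → Bits r) (L : List ((ι → Fin 2) × Fin r)) :
    List (Step n w) :=
  L.flatMap fun p => if g p.1 p.2 = 1 then multiFlip n a₀ 0 (pattern I p.1) as (out p.2) else []

variable (U : Matrix (Bits (n + 1)) (Bits (n + 1)) ℂ)

-- Only output wires change, so the table inputs and ancillas look the same to every entry and the
-- flips add up. The wire `a₀` is always `0` and serves as the trivially satisfied first control of
-- `multiFlip`.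
open Classical in
lemma applySteps_lookupSteps_list {I : ι → Fin w} {out : Fin r → Fin w} {a₀ : Fin w}
    {as : List (Fin w)} (g : (ι → Fin 2) → Bits r) (L : List ((ι → Fin 2) × Fin r))
    (hlen : Fintype.card ι ≤ as.length) (hnd : (a₀ :: as).Nodup)
    (hI : ∀ i, I i ∉ a₀ :: as) (hout : ∀ i, out i ∉ a₀ :: as) (hIout : ∀ i j, I i ≠ out j)
    (ψ : Bits w → ℂ) (z : Bits w) (hz : ∀ a ∈ a₀ :: as, z a = 0) :
    applySteps U (lookupSteps n I out a₀ as g L) ψ z =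
      ψ (z + (L.map fun p => if z ∘ I = p.1 then
        (Pi.single (out p.2) (g p.1 p.2) : Bits w) else 0).sum) := by
  induction L generalizing ψ with
  | nil => simp [lookupSteps]
  | cons p L ih =>
    have hcons : lookupSteps n I out a₀ as g (p :: L) =
        (if g p.1 p.2 = 1 then multiFlip n a₀ 0 (pattern I p.1) as (out p.2) else []) ++
          lookupSteps n I out a₀ as g L := by
      simp [lookupSteps]
    rw [hcons, applySteps_append, ih, List.map_cons, List.sum_cons, add_left_comm z, add_comm _ (z + _)]
    set z' := z + (L.map fun p => if z ∘ I = p.1 then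
        (Pi.single (out p.2) (g p.1 p.2) : Bits w) else 0).sum with hz'
    have hoff : ∀ j, (∀ i, j ≠ out i) → z' j = z j := by
      intro j hj
      have : ∀ L : List ((ι → Fin 2) × Fin r), (L.map fun p => if z ∘ I = p.1 then
          (Pi.single (out p.2) (g p.1 p.2) : Bits w) else 0).sum j = 0 := by
        intro L
        induction L with
        | nil => simp
        | cons p L ih =>
          rw [List.map_cons, List.sum_cons, Pi.add_apply, ih, add_zero]
          split_ifs
          · exact Pi.single_eq_of_ne (hj _) _
          · rfl
      rw [hz', Pi.add_apply, this, add_zero]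
    have hzI : ∀ i, z' (I i) = z (I i) := fun i => hoff _ fun j => hIout i j
    have hza : ∀ a ∈ a₀ :: as, z' a = 0 := fun a ha => by
      rw [hoff a fun i hi => hout i (hi ▸ ha), hz a ha]
    obtain ⟨hnd₀, hnd'⟩ := List.nodup_cons.1 hnd
    obtain ⟨hza₀, hza'⟩ := List.forall_mem_cons.1 hza
    have hsingle : ∀ o : Fin w, Function.update z' o (z' o + 1) = z' + Pi.single o 1 := by
      intro o
      funext j
      by_cases hj : j = o
      · subst hj; simp
      · simp [hj]
    have hg : g p.1 p.2 = 0 ∨ g p.1 p.2 = 1 := by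
      generalize g p.1 p.2 = b; revert b; decide
    rcases hg with hg | hg
    · simp [hg]
    · rw [if_pos hg, applySteps_multiFlip U _ _ _ _ _ _ _ _ hnd' hza' hnd₀]
      · simp only [forall_mem_pattern, hza₀, hzI, true_and, hg, hsingle, funext_iff,
          Function.comp_apply]
        by_cases hq : ∀ i, z (I i) = p.1 i
        · simp [hq]
        · simp [hq]
      · exact fun h => hout _ (List.mem_cons_of_mem _ h)
      · exact fun h => hout p.2 (by simp [h])
      · rw [forall_mem_pattern]
        exact fun i => ⟨fun h => hI i (List.mem_cons_of_mem _ h),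
          fun h => hI i (by simp at h; simp [h]), hIout i _⟩
      · rwa [length_pattern]

lemma applySteps_lookupSteps [DecidableEq ι] {I : ι → Fin w} {out : Fin r → Fin w} {a₀ : Fin w}
    {as : List (Fin w)} (g : (ι → Fin 2) → Bits r)
    (hlen : Fintype.card ι ≤ as.length) (hnd : (a₀ :: as).Nodup)
    (hI : ∀ i, I i ∉ a₀ :: as) (hout : ∀ i, out i ∉ a₀ :: as) (hIout : ∀ i j, I i ≠ out j)
    (ψ : Bits w → ℂ) (z : Bits w) (hz : ∀ a ∈ a₀ :: as, z a = 0) :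
    applySteps U (lookupSteps n I out a₀ as g Finset.univ.toList) ψ z =
      ψ (z + ∑ i, (Pi.single (out i) (g (z ∘ I) i) : Bits w)) := by
  rw [applySteps_lookupSteps_list U g _ hlen hnd hI hout hIout ψ z hz, Finset.sum_map_toList,
    Fintype.sum_prod_type, Finset.sum_eq_single (z ∘ I)]
  · simp
  · intro q _ hq
    simp [Ne.symm hq]
  · simp

end Lookup

/-! ### Concentration of phase and amplitude estimation -/

section PhaseEstimation

/-- The root of unity `exp (-2πi/M)`. -/
noncomputable def unityRoot (M : ℕ) : ℂ := (Complex.exp (2 * Real.pi * Complex.I / M))⁻¹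

lemma isPrimitiveRoot_unityRoot {M : ℕ} (hM : M ≠ 0) : IsPrimitiveRoot (unityRoot M) M :=
  (Complex.isPrimitiveRoot_exp M hM).inv

lemma unityRoot_pow (M k : ℕ) :
    unityRoot M ^ k = Complex.exp (-(2 * Real.pi * Complex.I * k / M)) := by
  rw [unityRoot, ← Complex.exp_neg, ← Complex.exp_nat_mul]
  congr 1
  ring

lemma norm_unityRoot (M : ℕ) : ‖unityRoot M‖ = 1 := by
  have := unityRoot_pow M 1
  rw [pow_one] at this
  rw [this, Complex.norm_exp]
  simp [Complex.div_re]

/-- Parseval's identity for the discrete Fourier transform. -/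
lemma sum_norm_sq_dft {M : ℕ} (hM : M ≠ 0) (c : ℕ → ℂ) :
    ∑ y ∈ Finset.range M, ‖∑ x ∈ Finset.range M, unityRoot M ^ (x * y) * c x‖ ^ 2 =
      M * ∑ x ∈ Finset.range M, ‖c x‖ ^ 2 := by
  have hω := isPrimitiveRoot_unityRoot hM
  have hω0 : unityRoot M ≠ 0 := hω.ne_zero hM
  have hconj : (starRingEnd ℂ) (unityRoot M) = (unityRoot M)⁻¹ :=
    (Complex.inv_eq_conj (norm_unityRoot M)).symm
  -- Orthogonality of characters: for `x ≠ x'` the ratio is a nontrivial `M`-th root of unity, so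
  -- the geometric sum vanishes.
  have hgeom : ∀ x ∈ Finset.range M, ∀ x' ∈ Finset.range M,
      ∑ y ∈ Finset.range M, (unityRoot M ^ x * (unityRoot M)⁻¹ ^ x') ^ y =
        if x = x' then (M : ℂ) else 0 := by
    intro x hx x' hx'
    split_ifs with h
    · subst h
      simp [hω0]
    · have hne : unityRoot M ^ x * (unityRoot M)⁻¹ ^ x' ≠ 1 := by
        intro H
        rw [inv_pow, mul_inv_eq_one₀ (pow_ne_zero _ hω0)] at H
        exact h (hω.pow_inj (Finset.mem_range.1 hx) (Finset.mem_range.1 hx') H)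
      rw [geom_sum_eq hne, mul_pow, ← pow_mul, ← pow_mul, mul_comm x, mul_comm x', pow_mul,
        pow_mul, hω.pow_eq_one, inv_pow, hω.pow_eq_one]
      simp
  apply Complex.ofReal_injective
  push_cast
  simp only [← Complex.mul_conj', map_sum, map_mul, map_pow, hconj, Finset.sum_mul_sum]
  rw [Finset.sum_comm, Finset.mul_sum]
  refine Finset.sum_congr rfl fun x hx => ?_
  rw [Finset.sum_comm]
  have : ∀ x' ∈ Finset.range M, ∑ y ∈ Finset.range M,
      unityRoot M ^ (x * y) * c x * ((unityRoot M)⁻¹ ^ (x' * y) * (starRingEnd ℂ) (c x')) =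
      if x = x' then M * (c x * (starRingEnd ℂ) (c x)) else 0 := by
    intro x' hx'
    have h := hgeom x hx x' hx'
    calc _ = c x * (starRingEnd ℂ) (c x') *
          ∑ y ∈ Finset.range M, (unityRoot M ^ x * (unityRoot M)⁻¹ ^ x') ^ y := by
          rw [Finset.mul_sum]
          refine Finset.sum_congr rfl fun y _ => ?_
          rw [mul_pow, ← pow_mul, ← pow_mul]
          ring
      _ = _ := by
          rw [h]
          split_ifs with hxx
          · subst hxx; ring
          · simp
  rw [Finset.sum_congr rfl this, Finset.sum_ite_eq, if_pos hx]

/-- The amplitudes of the outcomes of phase estimation for the eigenvalue `ξ`. -/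
noncomputable def phaseAmp (M : ℕ) (ξ : ℂ) (y : ℕ) : ℂ :=
  (M : ℂ)⁻¹ * ∑ x ∈ Finset.range M, unityRoot M ^ (x * y) * ξ ^ x

lemma sum_norm_sq_phaseAmp {M : ℕ} (hM : M ≠ 0) {ξ : ℂ} (hξ : ‖ξ‖ = 1) :
    ∑ y ∈ Finset.range M, ‖phaseAmp M ξ y‖ ^ 2 = 1 := by
  have hM' : (M : ℝ) ≠ 0 := Nat.cast_ne_zero.2 hM
  simp only [phaseAmp, norm_mul, mul_pow, ← Finset.mul_sum, sum_norm_sq_dft hM, norm_pow, hξ,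
    one_pow]
  simp
  field_simp

/-- The product `(1 - η)^M * (1 + η)^M` is at most `1`, and by Bernoulli the second factor is at
least `1 + M * η ≥ 2`. -/
lemma one_sub_pow_le_half {M : ℕ} {η : ℝ} (h0 : 0 < η) (h1 : η ≤ 1) (hM : 1 ≤ M * η) :
    (1 - η) ^ M ≤ 1 / 2 := by
  have hb := one_add_mul_le_pow (a := η) (by linarith) M
  have h2 : (1 - η) ^ M * (1 + η) ^ M ≤ 1 := by
    rw [← mul_pow]
    exact pow_le_one₀ (by nlinarith) (by nlinarith)
  have h3 : 0 ≤ (1 - η) ^ M := pow_nonneg (by linarith) M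
  nlinarith

/-- Phase estimation rarely makes a large error. -/
lemma sum_norm_sq_phaseAmp_filter_le {M : ℕ} {η : ℝ} (h0 : 0 < η) (h1 : η ≤ 1) (hM : 1 ≤ M * η)
    {ξ : ℂ} (hξ : ‖ξ‖ = 1) (s : Finset ℕ) (hs : s ⊆ Finset.range M)
    (hbad : ∀ y ∈ s, η ≤ ‖unityRoot M ^ y * ξ - 1‖) :
    ∑ y ∈ s, ‖phaseAmp M ξ y‖ ^ 2 ≤ 64 / (M * η) := by
  have hM0 : M ≠ 0 := by rintro rfl; simp at hM; linarith
  have hMpos : (0 : ℝ) < M := by exact_mod_cast Nat.pos_of_ne_zero hM0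
  -- The same sum with damping `(1 - η)^x`. At bad `y` it dominates `phaseAmp` up to the factor `8 /
  -- M`, while Parseval bounds its total weight by `M / η`.
  set b : ℕ → ℂ := fun y =>
    ∑ x ∈ Finset.range M, unityRoot M ^ (x * y) * (((1 - η : ℝ) : ℂ) ^ x * ξ ^ x) with hb
  have hgeo : ∀ (ρ : ℂ) (y : ℕ), ∑ x ∈ Finset.range M, unityRoot M ^ (x * y) * ρ ^ x =
      ∑ x ∈ Finset.range M, (unityRoot M ^ y * ρ) ^ x := fun ρ y =>
    Finset.sum_congr rfl fun x _ => by rw [mul_pow, ← pow_mul, mul_comm x]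
  have hpoint : ∀ y ∈ s, ‖phaseAmp M ξ y‖ ^ 2 ≤ 64 / (M : ℝ) ^ 2 * ‖b y‖ ^ 2 := by
    intro y hy
    have hbd := hbad y hy
    set ζ := unityRoot M ^ y * ξ with hζ
    have hζ1 : ‖ζ‖ = 1 := by rw [hζ, norm_mul, norm_pow, norm_unityRoot, hξ]; simp
    have ha : ‖phaseAmp M ξ y‖ * ‖ζ - 1‖ ≤ 2 / M := by
      rw [← norm_mul, phaseAmp, hgeo, mul_assoc, geom_sum_mul, norm_mul, norm_inv,
        Complex.norm_natCast, div_eq_inv_mul]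
      refine mul_le_mul_of_nonneg_left ?_ (by positivity)
      refine (norm_sub_le _ _).trans ?_
      rw [norm_pow, hζ1]
      norm_num
    -- In the closed form of the geometric sum `b y`, the numerator is at least `1/2` since `(1 -
    -- η)^M ≤ 1/2`, and the denominator is at most `2 * ‖ζ - 1‖` since `η ≤ ‖ζ - 1‖`.
    have hb1 : 1 / 2 ≤ ‖b y‖ * (2 * ‖ζ - 1‖) := by
      have e1 : b y * (((1 - η : ℝ) : ℂ) * ζ - 1) = (((1 - η : ℝ) : ℂ) * ζ) ^ M - 1 := by
        rw [← geom_sum_mul, hb]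
        congr 1
        refine Finset.sum_congr rfl fun x _ => ?_
        rw [hζ, mul_pow, mul_pow, ← pow_mul, mul_comm x]
        ring
      have e2 : 1 / 2 ≤ ‖(((1 - η : ℝ) : ℂ) * ζ) ^ M - 1‖ := by
        have e3 : ‖(((1 - η : ℝ) : ℂ) * ζ) ^ M‖ ≤ 1 / 2 := by
          rw [norm_pow, norm_mul, hζ1, mul_one, Complex.norm_real, Real.norm_eq_abs,
            abs_of_nonneg (by linarith)]
          exact one_sub_pow_le_half h0 h1 hM
        have := norm_sub_norm_le (1 : ℂ) ((((1 - η : ℝ) : ℂ) * ζ) ^ M)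
        rw [norm_sub_rev] at this
        rw [norm_one] at this
        linarith
      have e4 : ‖((1 - η : ℝ) : ℂ) * ζ - 1‖ ≤ 2 * ‖ζ - 1‖ := by
        have : ((1 - η : ℝ) : ℂ) * ζ - 1 = (ζ - 1) - (η : ℂ) * ζ := by push_cast; ring
        rw [this]
        refine (norm_sub_le _ _).trans ?_
        rw [norm_mul, hζ1, Complex.norm_real, Real.norm_eq_abs, abs_of_pos h0]
        linarith
      rw [← e1, norm_mul] at e2
      exact e2.trans (mul_le_mul_of_nonneg_left e4 (norm_nonneg _))
    have hc : ‖phaseAmp M ξ y‖ ≤ 8 / M * ‖b y‖ := by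
      have hp : 0 < ‖ζ - 1‖ := h0.trans_le hbd
      have : ‖phaseAmp M ξ y‖ * ‖ζ - 1‖ ≤ (8 / M * ‖b y‖) * ‖ζ - 1‖ := by
        refine ha.trans ?_
        calc (2 : ℝ) / M = 4 / M * (1 / 2) := by ring
          _ ≤ 4 / M * (‖b y‖ * (2 * ‖ζ - 1‖)) := mul_le_mul_of_nonneg_left hb1 (by positivity)
          _ = _ := by ring
      exact le_of_mul_le_mul_right this hp
    calc ‖phaseAmp M ξ y‖ ^ 2 ≤ (8 / M * ‖b y‖) ^ 2 := pow_le_pow_left₀ (norm_nonneg _) hc 2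
      _ = _ := by ring
  have hsum : ∑ y ∈ Finset.range M, ‖b y‖ ^ 2 ≤ M * (1 / η) := by
    rw [hb, sum_norm_sq_dft hM0]
    refine mul_le_mul_of_nonneg_left ?_ hMpos.le
    -- One of the two factors `(1 - η)^x` is dropped; the remaining geometric series is still at
    -- most `1 / η`.
    have hq : ∀ x, ‖(((1 - η : ℝ) : ℂ) ^ x * ξ ^ x)‖ ^ 2 ≤ (1 - η) ^ x := by
      intro x
      rw [norm_mul, norm_pow, norm_pow, hξ, one_pow, mul_one, Complex.norm_real,
        Real.norm_eq_abs, abs_of_nonneg (by linarith), sq]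
      exact mul_le_of_le_one_left (pow_nonneg (by linarith) _)
        (pow_le_one₀ (by linarith) (by linarith))
    refine (Finset.sum_le_sum fun x _ => hq x).trans ?_
    rw [le_div_iff₀ h0]
    have := geom_sum_mul (1 - η) M
    have h3 : 0 ≤ (1 - η) ^ M := pow_nonneg (by linarith) M
    linarith
  calc ∑ y ∈ s, ‖phaseAmp M ξ y‖ ^ 2 ≤ ∑ y ∈ s, 64 / (M : ℝ) ^ 2 * ‖b y‖ ^ 2 :=
        Finset.sum_le_sum hpoint
    _ ≤ ∑ y ∈ Finset.range M, 64 / (M : ℝ) ^ 2 * ‖b y‖ ^ 2 :=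
        Finset.sum_le_sum_of_subset_of_nonneg hs fun _ _ _ => by positivity
    _ = 64 / (M : ℝ) ^ 2 * ∑ y ∈ Finset.range M, ‖b y‖ ^ 2 := by rw [Finset.mul_sum]
    _ ≤ 64 / (M : ℝ) ^ 2 * (M * (1 / η)) := mul_le_mul_of_nonneg_left hsum (by positivity)
    _ = 64 / (M * η) := by field_simp

/-- The amplitudes of the outcomes of amplitude estimation, where `F` is `sin` or `cos`. -/
noncomputable def waveAmp (F : ℝ → ℝ) (M : ℕ) (θ : ℝ) (y : ℕ) : ℂ :=
  (M : ℂ)⁻¹ * ∑ x ∈ Finset.range M, unityRoot M ^ (x * y) * (F ((2 * x + 1) * θ) : ℂ)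

/-- By Euler's formula, `cos ± i sin` turns the two wave sums into phase estimation sums for `exp
(±2iθ)`, up to a factor of modulus one; the parallelogram law then gives the average. -/
lemma norm_sq_waveAmp_add (M : ℕ) (θ : ℝ) (y : ℕ) :
    ‖waveAmp Real.sin M θ y‖ ^ 2 + ‖waveAmp Real.cos M θ y‖ ^ 2 =
      (‖phaseAmp M (Complex.exp (Complex.I * (2 * θ : ℝ))) y‖ ^ 2 +
        ‖phaseAmp M (Complex.exp (Complex.I * (2 * -θ : ℝ))) y‖ ^ 2) / 2 := by
  -- Used only for `σ = 1` and `σ = -1`; the second alternative disposes of all other values.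
  have key : ∀ σ : ℝ, (waveAmp Real.cos M θ y + (σ : ℂ) * Complex.I * waveAmp Real.sin M θ y =
      Complex.exp (Complex.I * (σ * θ : ℝ)) *
        phaseAmp M (Complex.exp (Complex.I * (2 * (σ * θ) : ℝ))) y) ∨ (σ ≠ 1 ∧ σ ≠ -1) := by
    intro σ
    by_cases hσ : σ = 1 ∨ σ = -1
    · left
      rw [waveAmp, waveAmp, phaseAmp, mul_left_comm _ (M : ℂ)⁻¹, mul_left_comm _ (M : ℂ)⁻¹,
        ← mul_add, Finset.mul_sum, Finset.mul_sum, ← Finset.sum_add_distrib]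
      congr 1
      refine Finset.sum_congr rfl fun x _ => ?_
      rw [← Complex.exp_nat_mul, mul_left_comm (Complex.exp _), ← Complex.exp_add]
      have e : Complex.I * (σ * θ : ℝ) + x * (Complex.I * (2 * (σ * θ) : ℝ)) =
          ((σ * ((2 * x + 1) * θ) : ℝ) : ℂ) * Complex.I := by push_cast; ring
      rw [e, Complex.exp_mul_I, ← Complex.ofReal_cos, ← Complex.ofReal_sin]
      rcases hσ with rfl | rfl
      · simp; ring
      · simp; ring
    · right; push Not at hσ; exact hσ
  have h1 := (key 1).resolve_right (by simp)
  have h2 := (key (-1)).resolve_right (by norm_num)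
  have hp := parallelogram_law_with_norm ℝ (waveAmp Real.cos M θ y)
    (Complex.I * waveAmp Real.sin M θ y)
  have h1' : ‖waveAmp Real.cos M θ y + Complex.I * waveAmp Real.sin M θ y‖ =
      ‖phaseAmp M (Complex.exp (Complex.I * (2 * θ : ℝ))) y‖ := by
    have := congrArg norm h1
    rwa [norm_mul, Complex.norm_exp_I_mul_ofReal, one_mul, Complex.ofReal_one, one_mul,
      one_mul] at this
  have h2' : ‖waveAmp Real.cos M θ y - Complex.I * waveAmp Real.sin M θ y‖ =
      ‖phaseAmp M (Complex.exp (Complex.I * (2 * -θ : ℝ))) y‖ := by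
    have := congrArg norm h2
    rwa [norm_mul, Complex.norm_exp_I_mul_ofReal, one_mul, Complex.ofReal_neg,
      Complex.ofReal_one, neg_one_mul, neg_one_mul, neg_mul, ← sub_eq_add_neg] at this
  rw [h1', h2', norm_mul, Complex.norm_I, one_mul] at hp
  linarith

/-- The difference factors as `sin (b - a) * sin (-b - a)`. Bounding either factor by `1` shows that
an outcome with a bad value of `sin²` is far from both phases `b` and `-b`. -/
lemma abs_sin_sq_sub_sin_sq_le (a b : ℝ) :
    |Real.sin a ^ 2 - Real.sin b ^ 2| ≤ |Real.sin (b - a)| ∧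
      |Real.sin a ^ 2 - Real.sin b ^ 2| ≤ |Real.sin (-b - a)| := by
  have h : Real.sin a ^ 2 - Real.sin b ^ 2 = Real.sin (b - a) * Real.sin (-b - a) := by
    have : -b - a = -(b + a) := by ring
    rw [this, Real.sin_neg, Real.sin_sub, Real.sin_add]
    have h1 := Real.sin_sq_add_cos_sq a
    have h2 := Real.sin_sq_add_cos_sq b
    linear_combination (Real.sin b ^ 2) * h1 - (Real.sin a ^ 2) * h2
  rw [h, abs_mul]
  exact ⟨mul_le_of_le_one_right (abs_nonneg _) (Real.abs_sin_le_one _),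
    mul_le_of_le_one_left (abs_nonneg _) (Real.abs_sin_le_one _)⟩

/-- Amplitude estimation has a small error with high probability. -/
lemma le_sum_norm_sq_waveAmp {M : ℕ} {η : ℝ} (h0 : 0 < η) (h1 : η ≤ 1) (hM : 1 ≤ M * η) (θ : ℝ) :
    1 - 64 / (M * η) ≤ ∑ y ∈ (Finset.range M).filter fun y : ℕ =>
      |Real.sin (Real.pi * y / M) ^ 2 - Real.sin θ ^ 2| ≤ η / 2,
      (‖waveAmp Real.sin M θ y‖ ^ 2 + ‖waveAmp Real.cos M θ y‖ ^ 2) := by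
  have hM0 : M ≠ 0 := by rintro rfl; simp at hM; linarith
  have hn : ∀ θ : ℝ, ‖Complex.exp (Complex.I * (2 * θ : ℝ))‖ = 1 := fun θ =>
    Complex.norm_exp_I_mul_ofReal _
  have hdist : ∀ (θ : ℝ) (y : ℕ),
      ‖unityRoot M ^ y * Complex.exp (Complex.I * (2 * θ : ℝ)) - 1‖ =
        2 * |Real.sin (θ - Real.pi * y / M)| := by
    intro θ y
    rw [unityRoot_pow, ← Complex.exp_add]
    have : -(2 * Real.pi * Complex.I * y / M) + Complex.I * (2 * θ : ℝ) =
        Complex.I * (2 * (θ - Real.pi * y / M) : ℝ) := by push_cast; ring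
    rw [this, Complex.norm_exp_I_mul_ofReal_sub_one, norm_mul, Real.norm_eq_abs, Real.norm_eq_abs]
    norm_num
  set bad := (Finset.range M).filter fun y : ℕ =>
    ¬ |Real.sin (Real.pi * y / M) ^ 2 - Real.sin θ ^ 2| ≤ η / 2 with hbad
  -- One argument for both `σ = θ` and `σ = -θ`. The chord length is twice the sine, so an error
  -- above `η / 2` in `sin²` means a distance of at least `η` on the circle.
  have hbadle : ∀ σ : ℝ, (∀ a, |Real.sin a ^ 2 - Real.sin θ ^ 2| ≤ |Real.sin (σ - a)|) →
      ∑ y ∈ bad, ‖phaseAmp M (Complex.exp (Complex.I * (2 * σ : ℝ))) y‖ ^ 2 ≤ 64 / (M * η) := by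
    intro σ hσ
    refine sum_norm_sq_phaseAmp_filter_le h0 h1 hM (hn _) bad (Finset.filter_subset _ _) ?_
    intro y hy
    rw [hdist]
    have h2 := (Finset.mem_filter.1 hy).2
    have h3 := hσ (Real.pi * y / M)
    push Not at h2
    linarith
  have hplus := hbadle θ fun a => (abs_sin_sq_sub_sin_sq_le a θ).1
  have hminus := hbadle (-θ) fun a => (abs_sin_sq_sub_sin_sq_le a θ).2
  have htot := Finset.sum_filter_add_sum_filter_not (Finset.range M)
    (fun y : ℕ => |Real.sin (Real.pi * y / M) ^ 2 - Real.sin θ ^ 2| ≤ η / 2)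
    (fun y => ‖waveAmp Real.sin M θ y‖ ^ 2 + ‖waveAmp Real.cos M θ y‖ ^ 2)
  rw [← hbad] at htot
  have hall : ∑ y ∈ Finset.range M,
      (‖waveAmp Real.sin M θ y‖ ^ 2 + ‖waveAmp Real.cos M θ y‖ ^ 2) = 1 := by
    simp only [norm_sq_waveAmp_add]
    rw [← Finset.sum_div, Finset.sum_add_distrib, sum_norm_sq_phaseAmp hM0 (hn θ),
      sum_norm_sq_phaseAmp hM0 (hn (-θ))]
    norm_num
  have hb : ∑ y ∈ bad, (‖waveAmp Real.sin M θ y‖ ^ 2 + ‖waveAmp Real.cos M θ y‖ ^ 2) ≤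
      64 / (M * η) := by
    simp only [norm_sq_waveAmp_add]
    rw [← Finset.sum_div, Finset.sum_add_distrib]
    linarith
  linarith

end PhaseEstimation

/-! ### The Grover operator as a rotation -/

section Grover

variable {n : ℕ}

lemma ketTensor_cons (a b : Fin 2) (φ : EuclideanSpace ℂ (Bits n)) (u : Bits n) :
    ketTensor a φ (Fin.cons b u : Bits (n + 1)) = if b = a then φ u else 0 := by
  simp [ketTensor]

lemma sum_norm_sq_ketTensor (φ₀ φ₁ : EuclideanSpace ℂ (Bits n)) (h₀ : ‖φ₀‖ = 1) (h₁ : ‖φ₁‖ = 1)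
    (α β : ℂ) :
    ∑ u, ‖(α • ketTensor 0 φ₀ + β • ketTensor 1 φ₁) u‖ ^ 2 = ‖α‖ ^ 2 + ‖β‖ ^ 2 := by
  rw [EuclideanSpace.norm_eq, Real.sqrt_eq_one] at h₀ h₁
  rw [sum_bits_succ, Fin.sum_univ_two]
  simp [ketTensor_cons, mul_pow, ← Finset.mul_sum, h₀, h₁]

lemma sum_conj_ketTensor_mul (φ₀ φ₁ : EuclideanSpace ℂ (Bits n)) (h₀ : ‖φ₀‖ = 1) (h₁ : ‖φ₁‖ = 1)
    (s c α β : ℂ) :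
    ∑ u, (starRingEnd ℂ) ((s • ketTensor 0 φ₀ + c • ketTensor 1 φ₁) u) *
      (α • ketTensor 0 φ₀ + β • ketTensor 1 φ₁) u =
        (starRingEnd ℂ) s * α + (starRingEnd ℂ) c * β := by
  rw [EuclideanSpace.norm_eq, Real.sqrt_eq_one] at h₀ h₁
  have h : ∀ (s α : ℂ) (φ : EuclideanSpace ℂ (Bits n)), ∑ u, ‖φ u‖ ^ 2 = 1 →
      ∑ u, (starRingEnd ℂ) s * (starRingEnd ℂ) (φ u) * (α * φ u) = (starRingEnd ℂ) s * α := by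
    intro s α φ hφ
    have : ∀ u, (starRingEnd ℂ) s * (starRingEnd ℂ) (φ u) * (α * φ u) =
        (starRingEnd ℂ) s * α * ((‖φ u‖ ^ 2 : ℝ) : ℂ) := by
      intro u
      push_cast
      rw [← Complex.conj_mul']
      ring
    rw [Finset.sum_congr rfl fun u _ => this u, ← Finset.mul_sum, ← Complex.ofReal_sum, hφ]
    simp
  rw [sum_bits_succ, Fin.sum_univ_two]
  simp only [Pi.add_apply, Pi.smul_apply, smul_eq_mul, ketTensor_cons, if_true, map_mul, map_add]
  simp [h _ _ _ h₀, h _ _ _ h₁]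

variable (U : Matrix (Bits (n + 1)) (Bits (n + 1)) ℂ)

/-- Conjugating the reflection in `|0⟩` by `U` gives the reflection in `U|0⟩`. -/
lemma grover_eq (hU : U * Uᴴ = 1) (v : Bits (n + 1) → ℂ) :
    grover U v = reflectOne v -
      (2 * ∑ u, (starRingEnd ℂ) ((U *ᵥ ket 0) u) * reflectOne v u) • (U *ᵥ ket 0) := by
  have hket : ∀ u, (U *ᵥ ket 0) u = U u 0 := by
    intro u
    simp [Matrix.mulVec, dotProduct, ket]
  have h0 : (Uᴴ *ᵥ reflectOne v) 0 =
      ∑ u, (starRingEnd ℂ) ((U *ᵥ ket 0) u) * reflectOne v u := by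
    simp only [hket]
    rfl
  have hr : reflectZero (Uᴴ *ᵥ reflectOne v) =
      Uᴴ *ᵥ reflectOne v - (2 * (Uᴴ *ᵥ reflectOne v) 0) • ket 0 := by
    funext u
    by_cases hu : u = 0
    · subst hu
      simp [reflectZero, ket]
      ring
    · simp [reflectZero, ket, hu]
  rw [grover, hr, Matrix.mulVec_sub, Matrix.mulVec_mulVec, hU, Matrix.one_mulVec,
    Matrix.mulVec_smul, h0]

/-- A product of two plane reflections is a rotation by twice the angle between their axes. The sign
is flipped on the `|1⟩` part, not on the `|0⟩` part, so the usual global sign `-1` does not appear.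
-/
lemma grover_apply (hU : U * Uᴴ = 1) {φ₀ φ₁ : EuclideanSpace ℂ (Bits n)} (h₀ : ‖φ₀‖ = 1)
    (h₁ : ‖φ₁‖ = 1) {θ : ℝ}
    (hψ : U *ᵥ ket 0 =
      (Real.sin θ : ℂ) • ketTensor 0 φ₀ + (Real.cos θ : ℂ) • ketTensor 1 φ₁) (x : ℝ) :
    grover U ((Real.sin x : ℂ) • ketTensor 0 φ₀ + (Real.cos x : ℂ) • ketTensor 1 φ₁) =
      (Real.sin (x + 2 * θ) : ℂ) • ketTensor 0 φ₀ +
        (Real.cos (x + 2 * θ) : ℂ) • ketTensor 1 φ₁ := by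
  have hr : reflectOne ((Real.sin x : ℂ) • ketTensor 0 φ₀ + (Real.cos x : ℂ) • ketTensor 1 φ₁) =
      (Real.sin x : ℂ) • ketTensor 0 φ₀ + (-Real.cos x : ℂ) • ketTensor 1 φ₁ := by
    funext u
    by_cases hu : u 0 = 1
    · simp [reflectOne, ketTensor, hu]
    · simp [reflectOne, ketTensor, hu]
  rw [grover_eq U hU, hr, hψ, sum_conj_ketTensor_mul φ₀ φ₁ h₀ h₁, Complex.conj_ofReal,
    Complex.conj_ofReal, Real.sin_add, Real.cos_add, Real.sin_two_mul, Real.cos_two_mul]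
  have h2 : (Real.sin θ : ℂ) ^ 2 + (Real.cos θ : ℂ) ^ 2 = 1 := by
    exact_mod_cast Real.sin_sq_add_cos_sq θ
  funext u
  simp only [Pi.add_apply, Pi.sub_apply, Pi.smul_apply, smul_eq_mul]
  push_cast
  simp only [← Complex.ofReal_sin, ← Complex.ofReal_cos]
  linear_combination (-2 * (Real.sin x : ℂ) * ketTensor 0 φ₀ u) * h2

lemma grover_iterate (hU : U * Uᴴ = 1) {φ₀ φ₁ : EuclideanSpace ℂ (Bits n)} (h₀ : ‖φ₀‖ = 1)
    (h₁ : ‖φ₁‖ = 1) {θ : ℝ}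
    (hψ : U *ᵥ ket 0 =
      (Real.sin θ : ℂ) • ketTensor 0 φ₀ + (Real.cos θ : ℂ) • ketTensor 1 φ₁) (k : ℕ) :
    (grover U)^[k] (U *ᵥ ket 0) =
      (Real.sin ((2 * k + 1) * θ) : ℂ) • ketTensor 0 φ₀ +
        (Real.cos ((2 * k + 1) * θ) : ℂ) • ketTensor 1 φ₁ := by
  induction k with
  | zero => simp [hψ]
  | succ k ih =>
    rw [Function.iterate_succ_apply', ih, grover_apply U hU h₀ h₁ hψ]
    have : (2 * (k : ℝ) + 1) * θ + 2 * θ = (2 * ((k + 1 : ℕ) : ℝ) + 1) * θ := by push_cast; ring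
    rw [this]

end Grover

/-! ### Gate and query counts -/

section Cost

variable {n w : ℕ}

/-- The number of queries in a list of steps. -/
def queryCount (G : List (Step n w)) : ℕ := G.countP Step.isQuery

@[simp] lemma queryCount_nil : queryCount ([] : List (Step n w)) = 0 := rfl

@[simp] lemma queryCount_append (G H : List (Step n w)) :
    queryCount (G ++ H) = queryCount G + queryCount H := by
  simp [queryCount]

@[simp] lemma queryCount_query (e : Fin (n + 1) ↪ Fin w) (G : List (Step n w)) :
    queryCount (.query e :: G) = queryCount G + 1 := by
  simp [queryCount, List.countP_cons, Step.isQuery]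

@[simp] lemma queryCount_queryInv (e : Fin (n + 1) ↪ Fin w) (G : List (Step n w)) :
    queryCount (.queryInv e :: G) = queryCount G + 1 := by
  simp [queryCount, List.countP_cons, Step.isQuery]

@[simp] lemma queryCount_gate₁ (V : Matrix.unitaryGroup (Bits 1) ℂ) (a : Fin w) :
    queryCount (gate₁ n V a) = 0 := by
  simp [queryCount, gate₁, Step.isQuery]

@[simp] lemma queryCount_gate₂ (V : Matrix.unitaryGroup (Bits 2) ℂ) (a b : Fin w) :
    queryCount (gate₂ n V a b) = 0 := by
  unfold gate₂
  split_ifs <;> simp [queryCount, Step.isQuery]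

lemma length_gate₁ (V : Matrix.unitaryGroup (Bits 1) ℂ) (a : Fin w) :
    (gate₁ n V a).length = 1 := rfl

lemma length_gate₂_le (V : Matrix.unitaryGroup (Bits 2) ℂ) (a b : Fin w) :
    (gate₂ n V a b).length ≤ 1 := by
  unfold gate₂
  split_ifs <;> simp

@[simp] lemma queryCount_phaseGate (d : Fin 2 → Fin 2 → Circle) (a b : Fin w) :
    queryCount (phaseGate n d a b) = 0 := queryCount_gate₂ _ _ _

lemma length_phaseGate_le (d : Fin 2 → Fin 2 → Circle) (a b : Fin w) :
    (phaseGate n d a b).length ≤ 1 := length_gate₂_le _ _ _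

@[simp] lemma queryCount_flipGate (a : Fin w) (α : Fin 2) (b : Fin w) :
    queryCount (flipGate n a α b) = 0 := queryCount_gate₂ _ _ _

lemma length_flipGate_le (a : Fin w) (α : Fin 2) (b : Fin w) :
    (flipGate n a α b).length ≤ 1 := length_gate₂_le _ _ _

@[simp] lemma queryCount_toffoli (a : Fin w) (α : Fin 2) (b : Fin w) (β : Fin 2) (c : Fin w) :
    queryCount (toffoli n a α b β c) = 0 := by
  simp [toffoli]

lemma length_toffoli_le (a : Fin w) (α : Fin 2) (b : Fin w) (β : Fin 2) (c : Fin w) :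
    (toffoli n a α b β c).length ≤ 7 := by
  have h1 := length_flipGate_le (n := n) a α b
  have h2 := fun d => length_phaseGate_le (n := n) d b c
  have h3 := fun d => length_phaseGate_le (n := n) d a c
  simp only [toffoli, List.length_append, length_gate₁]
  have h2' := h2 (fun x y => if x = β ∧ y = 1 then circleI else 1)
  have h2i := h2 (fun x y => if x = β ∧ y = 1 then circleI⁻¹ else 1)
  have h3' := h3 (fun x y => if x = α ∧ y = 1 then circleI else 1)
  omega

@[simp] lemma queryCount_multiFlip (c : Fin w) (γ : Fin 2) (ps : List (Fin w × Fin 2))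
    (as : List (Fin w)) (tgt : Fin w) : queryCount (multiFlip n c γ ps as tgt) = 0 := by
  induction ps generalizing c γ as with
  | nil => simp [multiFlip]
  | cons p ps ih =>
    cases as with
    | nil => simp [multiFlip]
    | cons a as => simp [multiFlip, ih]

/-- Each further control costs two Toffoli circuits of at most `7` gates; the innermost flip is one
gate. -/
lemma length_multiFlip_le (c : Fin w) (γ : Fin 2) (ps : List (Fin w × Fin 2))
    (as : List (Fin w)) (tgt : Fin w) :
    (multiFlip n c γ ps as tgt).length ≤ 14 * ps.length + 1 := by
  induction ps generalizing c γ as with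
  | nil => simpa [multiFlip] using length_flipGate_le c γ tgt
  | cons p ps ih =>
    cases as with
    | nil => simp [multiFlip]
    | cons a as =>
      have h1 := length_toffoli_le (n := n) c γ p.1 p.2 a
      have h2 := ih a 1 as
      simp only [multiFlip, List.length_append, List.length_cons]
      omega

@[simp] lemma queryCount_phaseLadder (q : Fin w) (N m : ℕ) (e : Fin m → Fin w) :
    queryCount (phaseLadder n q N m e) = 0 := by
  induction m with
  | zero => simp [phaseLadder]
  | succ m ih => simp [phaseLadder, ih]

lemma length_phaseLadder_le (q : Fin w) (N m : ℕ) (e : Fin m → Fin w) :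
    (phaseLadder n q N m e).length ≤ m := by
  induction m with
  | zero => simp [phaseLadder]
  | succ m ih =>
    rw [phaseLadder, List.length_append]
    exact (add_le_add (length_phaseGate_le _ _ _) (ih _)).trans (Nat.add_comm 1 m).le

@[simp] lemma queryCount_fourier (m : ℕ) (e : Fin m → Fin w) :
    queryCount (fourier n m e) = 0 := by
  induction m with
  | zero => simp [fourier]
  | succ m ih => simp [fourier, ih]

lemma length_fourier_le (m : ℕ) (e : Fin m → Fin w) : (fourier n m e).length ≤ (m + 1) ^ 2 := by
  induction m with
  | zero => simp [fourier]
  | succ m ih =>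
    have h1 := length_phaseLadder_le (n := n) (e 0) (2 ^ (m + 1)) m (fun i => e i.succ)
    have h2 := ih fun i => e i.succ
    simp only [fourier, List.length_append, length_gate₁]
    nlinarith

lemma queryCount_groverSteps (q : Fin w) (Y : Fin (n + 1) ↪ Fin w) (f : Fin w)
    (as : List (Fin w)) : queryCount (groverSteps q Y f as) = 2 := by
  simp [groverSteps, reflectOneSteps, reflectZeroSteps]

/-- Two zero tests of at most `14 * (n + 1) + 1` gates, two phase gates and two queries. -/
lemma length_groverSteps_le (q : Fin w) (Y : Fin (n + 1) ↪ Fin w) (f : Fin w)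
    (as : List (Fin w)) : (groverSteps q Y f as).length ≤ 34 * (n + 1) := by
  have h1 := length_multiFlip_le (n := n) q 1 (pattern Y 0) as f
  rw [length_pattern, Fintype.card_fin] at h1
  have h2 := length_phaseGate_le (n := n) (fun _ y => if y = 1 then circleI * circleI else 1) q f
  have h3 := length_phaseGate_le (n := n)
    (fun x y => if x = 1 ∧ y = 1 then circleI * circleI else 1) q (Y 0)
  simp only [groverSteps, reflectOneSteps, reflectZeroSteps, List.length_append, List.length_cons,
    List.length_nil]
  omega

lemma queryCount_groverPowSteps (Y : Fin (n + 1) ↪ Fin w) (f : Fin w) (as : List (Fin w)) (m : ℕ)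
    (e : Fin m → Fin w) : queryCount (groverPowSteps Y f as m e) ≤ 2 * 2 ^ m := by
  have hrep : ∀ (G : List (Step n w)) (k : ℕ),
      queryCount (List.replicate k G).flatten = k * queryCount G := by
    intro G k
    induction k with
    | zero => simp
    | succ k ih => rw [List.replicate_succ, List.flatten_cons, queryCount_append, ih]; ring
  induction m with
  | zero => simp [groverPowSteps]
  | succ m ih =>
    rw [groverPowSteps, queryCount_append, hrep, queryCount_groverSteps, pow_succ]
    have := ih fun i => e i.succ
    omega

lemma length_groverPowSteps_le (Y : Fin (n + 1) ↪ Fin w) (f : Fin w) (as : List (Fin w)) (m : ℕ)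
    (e : Fin m → Fin w) : (groverPowSteps Y f as m e).length ≤ 34 * (n + 1) * 2 ^ m := by
  induction m with
  | zero => simp [groverPowSteps]
  | succ m ih =>
    rw [groverPowSteps, List.length_append, List.length_flatten, List.map_replicate,
      List.sum_replicate, smul_eq_mul, pow_succ]
    have h1 := Nat.mul_le_mul_left (2 ^ m) (length_groverSteps_le (e 0) Y f as)
    have h2 := ih fun i => e i.succ
    linarith

variable {r : ℕ} {ι : Type*} [Fintype ι]

lemma queryCount_lookupSteps (I : ι → Fin w) (out : Fin r → Fin w) (a₀ : Fin w)
    (as : List (Fin w)) (g : (ι → Fin 2) → Bits r) (L : List ((ι → Fin 2) × Fin r)) :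
    queryCount (lookupSteps n I out a₀ as g L) = 0 := by
  induction L with
  | nil => simp [lookupSteps]
  | cons p L ih =>
    rw [lookupSteps, List.flatMap_cons, queryCount_append]
    rw [lookupSteps] at ih
    rw [ih]
    split_ifs <;> simp

lemma length_lookupSteps_le (I : ι → Fin w) (out : Fin r → Fin w) (a₀ : Fin w)
    (as : List (Fin w)) (g : (ι → Fin 2) → Bits r) (L : List ((ι → Fin 2) × Fin r)) :
    (lookupSteps n I out a₀ as g L).length ≤ L.length * (14 * Fintype.card ι + 1) := by
  induction L with
  | nil => simp [lookupSteps]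
  | cons p L ih =>
    rw [lookupSteps, List.flatMap_cons, List.length_append, List.length_cons, add_mul, one_mul,
      add_comm]
    refine add_le_add ih ?_
    split_ifs
    · refine (length_multiFlip_le _ _ _ _ _).trans ?_
      rw [length_pattern]
    · simp

end Cost

/-! ### The estimation circuit and its outcome probabilities -/

section Algorithm

/-- The qubits of the algorithm: the input, the phase register, the register of the oracle, the
output, two special ancillas and the ancillas for multiply controlled gates. -/
abbrev Wires (l t n a : ℕ) : Type :=
  -- The last block is large enough for the `n + 1` controls of the zero test and for the `l + t`
  -- controls of the table; both uses return it to `0`.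
  Fin l ⊕ Fin t ⊕ Fin (n + 1) ⊕ Fin a ⊕ Fin 2 ⊕ Fin (l + t + n + 1)

variable {l t n a : ℕ}

/-- The numbering of the qubits. -/
noncomputable def wireEquiv (l t n a : ℕ) :
    Wires l t n a ≃ Fin (Fintype.card (Wires l t n a)) := Fintype.equivFin _

/-- The basis label with the given contents of the registers and `0` on the ancillas. -/
noncomputable def label (s : Bits l) (y : Bits t) (u : Bits (n + 1)) (o : Bits a) :
    Bits (Fintype.card (Wires l t n a)) := fun j =>
  Sum.elim s (Sum.elim y (Sum.elim u (Sum.elim o fun _ => 0))) ((wireEquiv l t n a).symm j)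

/-- The input register. -/
noncomputable def inReg (l t n a : ℕ) : Fin l ↪ Fin (Fintype.card (Wires l t n a)) :=
  ⟨fun i => wireEquiv l t n a (.inl i), fun i j h => by simpa using h⟩

/-- The phase register. -/
noncomputable def phaseReg (l t n a : ℕ) : Fin t ↪ Fin (Fintype.card (Wires l t n a)) :=
  ⟨fun i => wireEquiv l t n a (.inr (.inl i)), fun i j h => by simpa using h⟩

/-- The register to which the oracle is applied. -/
noncomputable def oracleReg (l t n a : ℕ) :
    Fin (n + 1) ↪ Fin (Fintype.card (Wires l t n a)) :=
  ⟨fun i => wireEquiv l t n a (.inr (.inr (.inl i))), fun i j h => by simpa using h⟩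

/-- The output register. -/
noncomputable def outReg (l t n a : ℕ) : Fin a ↪ Fin (Fintype.card (Wires l t n a)) :=
  ⟨fun i => wireEquiv l t n a (.inr (.inr (.inr (.inl i)))), fun i j h => by simpa using h⟩

/-- The two special ancillas. -/
noncomputable def flagWire (l t n a : ℕ) (b : Fin 2) : Fin (Fintype.card (Wires l t n a)) :=
  wireEquiv l t n a (.inr (.inr (.inr (.inr (.inl b)))))

/-- The ancillas. -/
noncomputable def ancillas (l t n a : ℕ) : List (Fin (Fintype.card (Wires l t n a))) :=
  (List.finRange (l + t + n + 1)).map fun i =>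
    wireEquiv l t n a (.inr (.inr (.inr (.inr (.inr i)))))

/-- The wires that the table of the classical postprocessing reads. -/
noncomputable def tableReg (l t n a : ℕ) :
    Fin l ⊕ Fin t → Fin (Fintype.card (Wires l t n a)) :=
  Sum.elim (inReg l t n a) (phaseReg l t n a)

/-- The table of the classical postprocessing. -/
def tableOf (G : Bits l → ℕ → Bits a) (q : Fin l ⊕ Fin t → Fin 2) : Bits a :=
  G (fun i => q (.inl i)) (littleVal fun i => q (.inr i))

lemma inReg_apply (i : Fin l) : inReg l t n a i = wireEquiv l t n a (.inl i) := rfl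

lemma phaseReg_apply (i : Fin t) : phaseReg l t n a i = wireEquiv l t n a (.inr (.inl i)) := rfl

lemma oracleReg_apply (i : Fin (n + 1)) :
    oracleReg l t n a i = wireEquiv l t n a (.inr (.inr (.inl i))) := rfl

lemma outReg_apply (i : Fin a) :
    outReg l t n a i = wireEquiv l t n a (.inr (.inr (.inr (.inl i)))) := rfl

/-- The circuit of amplitude estimation, followed by a classical function `G` of the input and the
measured phase. -/
noncomputable def estimationSteps (l t n a : ℕ) (G : Bits l → ℕ → Bits a) :
    List (Step n (Fintype.card (Wires l t n a))) :=
  fourier n t (phaseReg l t n a) ++ (.query (oracleReg l t n a) ::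
    (groverPowSteps (oracleReg l t n a) (flagWire l t n a 0) (ancillas l t n a) t
      (phaseReg l t n a) ++ (fourier n t (phaseReg l t n a) ++
        lookupSteps n (tableReg l t n a) (outReg l t n a) (flagWire l t n a 1) (ancillas l t n a)
          (tableOf G) Finset.univ.toList)))

/-- The algorithm with the circuit `estimationSteps`. -/
noncomputable def estimation (l t n a : ℕ) (G : Bits l → ℕ → Bits a) : QueryAlgorithm n l where
  width := Fintype.card (Wires l t n a)
  outLen := a
  inWires := inReg l t n a
  outWires := outReg l t n a
  steps := estimationSteps l t n a G

lemma queries_estimation_le (G : Bits l → ℕ → Bits a) :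
    (estimation l t n a G).queries ≤ 2 * 2 ^ t + 1 := by
  change queryCount (estimationSteps l t n a G) ≤ _
  simp only [estimationSteps, queryCount_append, queryCount_query, queryCount_fourier, queryCount_lookupSteps]
  have := queryCount_groverPowSteps (oracleReg l t n a) (flagWire l t n a 0) (ancillas l t n a) t
    (phaseReg l t n a)
  omega

lemma time_estimation_le (G : Bits l → ℕ → Bits a) :
    (estimation l t n a G).time ≤ 2 * (t + 1) ^ 2 + 1 + 34 * (n + 1) * 2 ^ t +
      2 ^ l * 2 ^ t * a * (14 * (l + t) + 1) := by
  change (estimationSteps l t n a G).length ≤ _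
  simp only [estimationSteps, List.length_append, List.length_cons]
  have h1 := length_fourier_le (n := n) t (phaseReg l t n a)
  have h2 := length_groverPowSteps_le (oracleReg l t n a) (flagWire l t n a 0) (ancillas l t n a) t
    (phaseReg l t n a)
  have h3 := length_lookupSteps_le (n := n) (tableReg l t n a) (outReg l t n a)
    (flagWire l t n a 1) (ancillas l t n a) (tableOf G) Finset.univ.toList
  have h4 : (Finset.univ.toList : List ((Fin l ⊕ Fin t → Fin 2) × Fin a)).length =
      2 ^ l * 2 ^ t * a := by
    simp [pow_add]
  have h5 : Fintype.card (Fin l ⊕ Fin t) = l + t := by simp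
  rw [h4, h5] at h3
  omega

section Label

variable (s : Bits l) (y : Bits t) (u : Bits (n + 1)) (o : Bits a)

@[simp] lemma label_inReg (i : Fin l) : label s y u o (inReg l t n a i) = s i := by
  simp [label, inReg_apply]

@[simp] lemma label_phaseReg (i : Fin t) : label s y u o (phaseReg l t n a i) = y i := by
  simp [label, phaseReg_apply]

@[simp] lemma label_oracleReg (i : Fin (n + 1)) :
    label s y u o (oracleReg l t n a i) = u i := by
  simp [label, oracleReg_apply]

@[simp] lemma label_outReg (i : Fin a) : label s y u o (outReg l t n a i) = o i := by
  simp [label, outReg_apply]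

@[simp] lemma label_flagWire (b : Fin 2) : label s y u o (flagWire l t n a b) = 0 := by
  simp [label, flagWire]

lemma label_ancillas : ∀ b ∈ ancillas l t n a, label s y u o b = 0 := by
  intro b hb
  obtain ⟨i, -, rfl⟩ := List.mem_map.1 hb
  simp [label]

end Label

lemma start_estimation (G : Bits l → ℕ → Bits a) (s : Bits l) :
    (estimation l t n a G).start s = label s 0 0 0 := by
  funext j
  obtain ⟨j, rfl⟩ := (wireEquiv l t n a).surjective j
  rw [label, Equiv.symm_apply_apply]
  change Function.extend (inReg l t n a) s (fun _ => 0) _ = _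
  by_cases hj : ∃ i, inReg l t n a i = wireEquiv l t n a j
  · obtain ⟨i, hi⟩ := hj
    rw [← hi, (inReg l t n a).injective.extend_apply]
    have : j = .inl i := ((wireEquiv l t n a).injective hi).symm
    rw [this]
    rfl
  · rw [Function.extend_apply' _ _ _ hj]
    rcases j with i | i | i | i | i
    · exact absurd ⟨i, rfl⟩ hj
    all_goals rfl

lemma nodup_ancillas : (ancillas l t n a).Nodup := by
  refine (List.nodup_finRange _).map ?_
  intro i j h
  simpa using h

lemma isLayout_label (s : Bits l) :
    IsLayout (phaseReg l t n a) (oracleReg l t n a) (flagWire l t n a 0) (ancillas l t n a)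
      (label s 0 0 0) where
  P_ne_Y i j := by simp [phaseReg_apply, oracleReg_apply]
  P_ne_f i := by simp [phaseReg_apply, flagWire]
  Y_ne_f i := by simp [oracleReg_apply, flagWire]
  nodup := nodup_ancillas
  f_notMem := by simp [flagWire, ancillas]
  P_notMem i := by simp [phaseReg_apply, ancillas]
  Y_notMem i := by simp [oracleReg_apply, ancillas]
  base_f := by simp
  base_as := label_ancillas s 0 0 0
  length_le := by simp [ancillas]

lemma agreesOff_label (s : Bits l) (z : Bits (Fintype.card (Wires l t n a)))
    (hs : ∀ i, z (inReg l t n a i) = s i) (ho : ∀ i, z (outReg l t n a i) = 0)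
    (hf : ∀ b, z (flagWire l t n a b) = 0) (has : ∀ b ∈ ancillas l t n a, z b = 0) :
    AgreesOff (phaseReg l t n a) (oracleReg l t n a) (label s 0 0 0) z := by
  intro j hP hY
  obtain ⟨j, rfl⟩ := (wireEquiv l t n a).surjective j
  rw [label, Equiv.symm_apply_apply]
  rcases j with i | i | i | i | i | i
  · exact hs i
  · exact absurd ⟨i, rfl⟩ hP
  · exact absurd ⟨i, rfl⟩ hY
  · exact ho i
  · exact hf i
  · exact has _ (List.mem_map.2 ⟨i, List.mem_finRange i, rfl⟩)

lemma represents_start (s : Bits l) :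
    Represents (phaseReg l t n a) (oracleReg l t n a) (label s 0 0 0) (ket (label s 0 0 0))
      (fun y u => if y = 0 then ket 0 u else 0) := by
  intro z hz
  have h : z = label s 0 0 0 ↔ z ∘ phaseReg l t n a = 0 ∧ z ∘ oracleReg l t n a = 0 := by
    constructor
    · rintro rfl
      constructor <;> funext i <;> simp
    · rintro ⟨h1, h2⟩
      funext j
      by_cases hP : j ∈ Set.range (phaseReg l t n a)
      · obtain ⟨i, rfl⟩ := hP
        simpa using congrFun h1 i
      · by_cases hY : j ∈ Set.range (oracleReg l t n a)
        · obtain ⟨i, rfl⟩ := hY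
          simpa using congrFun h2 i
        · exact hz j hP hY
  simp only [ket, h, ite_and]

lemma grover_smul (U : Matrix (Bits (n + 1)) (Bits (n + 1)) ℂ) (α : ℂ) (v : Bits (n + 1) → ℂ) :
    grover U (α • v) = α • grover U v := by
  have h1 : reflectOne (α • v) = α • reflectOne v := by
    funext u; by_cases hu : u 0 = 1 <;> simp [reflectOne, hu]
  have h2 : ∀ v : Bits (n + 1) → ℂ, reflectZero (α • v) = α • reflectZero v := by
    intro v; funext u; by_cases hu : u = 0 <;> simp [reflectZero, hu]
  rw [grover, h1, Matrix.mulVec_smul, h2, Matrix.mulVec_smul, grover]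

lemma grover_iterate_smul (U : Matrix (Bits (n + 1)) (Bits (n + 1)) ℂ) (α : ℂ) (k : ℕ)
    (v : Bits (n + 1) → ℂ) : (grover U)^[k] (α • v) = α • (grover U)^[k] v := by
  induction k with
  | zero => rfl
  | succ k ih => rw [Function.iterate_succ_apply', Function.iterate_succ_apply', ih, grover_smul]

lemma inv_sqrt_two_pow_mul_self (t : ℕ) :
    ((Real.sqrt 2 : ℝ) : ℂ)⁻¹ ^ t * ((Real.sqrt 2 : ℝ) : ℂ)⁻¹ ^ t = ((2 ^ t : ℕ) : ℂ)⁻¹ := by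
  rw [← mul_pow, ← mul_inv, ← Complex.ofReal_mul, Real.mul_self_sqrt (by norm_num)]
  push_cast
  rw [inv_pow]

lemma bigVal_zero (t : ℕ) : bigVal (0 : Bits t) = 0 := by
  induction t with
  | zero => rfl
  | succ t ih =>
    rw [bigVal]
    change (0 : ℕ) * 2 ^ t + bigVal (0 : Bits t) = 0
    rw [ih, zero_mul]

/-- One factor `2^(-t/2)` is the amplitude of the uniform superposition, the other belongs to the
kernel; together they are the `1 / M` of `waveAmp`. -/
lemma sum_fourierKernel_wave (y : Bits t) (F : ℝ → ℝ) (θ : ℝ) :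
    ∑ x : Bits t, fourierKernel x y *
      (((Real.sqrt 2 : ℝ) : ℂ)⁻¹ ^ t * (F ((2 * bigVal x + 1) * θ) : ℂ)) =
        waveAmp F (2 ^ t) θ (littleVal y) := by
  have := sum_bigVal t fun k => ((2 ^ t : ℕ) : ℂ)⁻¹ *
    (unityRoot (2 ^ t) ^ (k * littleVal y) * (F ((2 * k + 1) * θ) : ℂ))
  rw [waveAmp, Finset.mul_sum, ← this]
  refine Finset.sum_congr rfl fun x _ => ?_
  rw [fourierKernel, unityRoot_pow, ← inv_sqrt_two_pow_mul_self]
  push_cast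
  simp only [mul_assoc]
  ring

/-- The most significant phase qubit comes first in the exponent of the Grover power, whereas the
outcome is read with the least significant qubit first, because `fourier` reverses the bits. -/
lemma represents_estimation (U : Matrix (Bits (n + 1)) (Bits (n + 1)) ℂ) (hU : U * Uᴴ = 1)
    {φ₀ φ₁ : EuclideanSpace ℂ (Bits n)} (h₀ : ‖φ₀‖ = 1) (h₁ : ‖φ₁‖ = 1) {θ : ℝ}
    (hψ : U *ᵥ ket 0 =
      (Real.sin θ : ℂ) • ketTensor 0 φ₀ + (Real.cos θ : ℂ) • ketTensor 1 φ₁) (s : Bits l) :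
    Represents (phaseReg l t n a) (oracleReg l t n a) (label s 0 0 0)
      (applySteps U (fourier n t (phaseReg l t n a))
        (applySteps U (groverPowSteps (oracleReg l t n a) (flagWire l t n a 0)
          (ancillas l t n a) t (phaseReg l t n a))
          (onWires (oracleReg l t n a) U *ᵥ applySteps U (fourier n t (phaseReg l t n a))
            (ket (label s 0 0 0)))))
      (fun y => waveAmp Real.sin (2 ^ t) θ (littleVal y) • ketTensor 0 φ₀ +
        waveAmp Real.cos (2 ^ t) θ (littleVal y) • ketTensor 1 φ₁) := by
  have hL := isLayout_label (l := l) (t := t) (n := n) (a := a) s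
  have h1 := (((represents_start s).fourier U hL).onWires hL U).groverPow U hL hU id
  have h2 := h1.fourier U hL
  refine Eq.mpr (congrArg (Represents _ _ _ _) (funext fun y => funext fun u => ?_)) h2
  -- On the zero string the transform is constant, so it prepares the uniform superposition and no
  -- separate Hadamard layer is needed.
  have hc : ∀ x : Bits t, (fun u : Bits (n + 1) => ∑ x', fourierKernel x' x *
      (if x' = 0 then ket 0 u else 0)) = ((Real.sqrt 2 : ℝ) : ℂ)⁻¹ ^ t • ket 0 := by
    intro x
    funext u
    rw [Finset.sum_eq_single 0 (by intro x' _ hx'; simp [hx']) (by simp)]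
    simp [fourierKernel, bigVal_zero]
  simp only [hc, Matrix.mulVec_smul, grover_iterate_smul, id]
  simp only [grover_iterate U hU h₀ h₁ hψ, ← sum_fourierKernel_wave, Pi.add_apply, Pi.smul_apply,
    smul_eq_mul, Finset.sum_mul]
  rw [← Finset.sum_add_distrib]
  refine Finset.sum_congr rfl fun x _ => ?_
  ring

open Classical in
/-- The outcomes of `estimation` are at least as likely as in amplitude estimation. -/
lemma le_outProb_estimation (G : Bits l → ℕ → Bits a)
    (U : Matrix (Bits (n + 1)) (Bits (n + 1)) ℂ) (hU : U * Uᴴ = 1)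
    {φ₀ φ₁ : EuclideanSpace ℂ (Bits n)} (h₀ : ‖φ₀‖ = 1) (h₁ : ‖φ₁‖ = 1) {θ : ℝ}
    (hψ : U *ᵥ ket 0 =
      (Real.sin θ : ℂ) • ketTensor 0 φ₀ + (Real.cos θ : ℂ) • ketTensor 1 φ₁) (s : Bits l) (v : ℝ) :
    ∑ y ∈ (Finset.range (2 ^ t)).filter (fun y => (bigVal (G s y) : ℝ) / 2 ^ a = v),
      (‖waveAmp Real.sin (2 ^ t) θ y‖ ^ 2 + ‖waveAmp Real.cos (2 ^ t) θ y‖ ^ 2) ≤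
        (estimation l t n a G).outProb U s v := by
  have hR := represents_estimation (t := t) (a := a) U hU h₀ h₁ hψ s
  set ψ := applySteps U (fourier n t (phaseReg l t n a))
        (applySteps U (groverPowSteps (oracleReg l t n a) (flagWire l t n a 0)
          (ancillas l t n a) t (phaseReg l t n a))
          (onWires (oracleReg l t n a) U *ᵥ applySteps U (fourier n t (phaseReg l t n a))
            (ket (label s 0 0 0)))) with hψ'
  have hfinal : (estimation l t n a G).finalState U s = applySteps U
      (lookupSteps n (tableReg l t n a) (outReg l t n a) (flagWire l t n a 1) (ancillas l t n a)
          (tableOf G) Finset.univ.toList) ψ := by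
    rw [hψ', ← applySteps_append]
    change applySteps U (estimationSteps l t n a G) (ket ((estimation l t n a G).start s)) = _
    rw [start_estimation, estimationSteps, applySteps_append, applySteps_cons, applySteps_append]
    rfl
  -- The labels with clean ancillas and the table value for the phase on the output wires.
  let Z : Bits t × Bits (n + 1) → Bits (Fintype.card (Wires l t n a)) := fun q =>
    label s q.1 q.2 (G s (littleVal q.1))
  have hZ : Function.Injective Z := by
    rintro ⟨y, u⟩ ⟨y', u'⟩ h
    have hy : y = y' := funext fun i => by
      simpa [Z] using congrFun h (phaseReg l t n a i)
    have hu : u = u' := funext fun i => by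
      simpa [Z] using congrFun h (oracleReg l t n a i)
    rw [hy, hu]
  have hval : ∀ q, (estimation l t n a G).outValue (Z q) =
      (bigVal (G s (littleVal q.1)) : ℝ) / 2 ^ a := by
    intro q
    rw [bigVal_eq_sum]
    change ∑ i : Fin a, ((Z q (outReg l t n a i) : ℕ) : ℝ) / _ = _
    simp [Z]
  have hamp : ∀ q, (estimation l t n a G).finalState U s (Z q) =
      (waveAmp Real.sin (2 ^ t) θ (littleVal q.1) • ketTensor 0 φ₀ +
        waveAmp Real.cos (2 ^ t) θ (littleVal q.1) • ketTensor 1 φ₁) q.2 := by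
    intro q
    rw [hfinal, applySteps_lookupSteps]
    · have htab : tableOf G (Z q ∘ tableReg l t n a) = G s (littleVal q.1) := by
        simp [tableOf, tableReg, Z]
      rw [htab]
      set z' := Z q + ∑ i, (Pi.single (outReg l t n a i) (G s (littleVal q.1) i) :
        Bits (Fintype.card (Wires l t n a))) with hz'
      have hoff : ∀ j, (∀ i, j ≠ outReg l t n a i) → z' j = Z q j := by
        intro j hj
        rw [hz', Pi.add_apply, Finset.sum_apply, Finset.sum_eq_zero, add_zero]
        exact fun i _ => Pi.single_eq_of_ne (hj i) _
      have hP : z' ∘ phaseReg l t n a = q.1 := funext fun i => by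
        rw [Function.comp_apply, hoff _ (by simp [phaseReg_apply, outReg_apply])]
        simp [Z]
      have hY : z' ∘ oracleReg l t n a = q.2 := funext fun i => by
        rw [Function.comp_apply, hoff _ (by simp [oracleReg_apply, outReg_apply])]
        simp [Z]
      rw [hR z', hP, hY]
      refine agreesOff_label s z' ?_ ?_ ?_ ?_
      · intro i
        rw [hoff _ (by simp [inReg_apply, outReg_apply])]
        simp [Z]
      · intro i
        -- Pulling back through the table adds the output bit to itself modulo 2, which clears the
        -- output register.
        rw [hz', Pi.add_apply, Finset.sum_apply, Finset.sum_eq_single i]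
        · simp only [Z, label_outReg, Pi.single_eq_same]
          generalize G s (littleVal q.1) i = b
          revert b; decide
        · intro k _ hk
          exact Pi.single_eq_of_ne ((outReg l t n a).injective.ne hk.symm) _
        · simp
      · intro b
        rw [hoff _ (by simp [flagWire, outReg_apply])]
        simp [Z]
      · intro b hb
        rw [hoff _ (by rintro i rfl; simp [ancillas, outReg_apply] at hb)]
        exact label_ancillas _ _ _ _ b hb
    · simp [ancillas]; omega
    · exact List.nodup_cons.2 ⟨by simp [flagWire, ancillas], nodup_ancillas⟩
    · rintro (i | i) <;> simp [tableReg, inReg_apply, phaseReg_apply, flagWire, ancillas]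
    · intro i; simp [outReg_apply, flagWire, ancillas]
    · rintro (i | i) j <;> simp [tableReg, inReg_apply, phaseReg_apply, outReg_apply]
    · intro b hb
      rcases List.mem_cons.1 hb with rfl | hb
      · simp [Z]
      · exact label_ancillas _ _ _ _ b hb
  have hsum : ∑ y ∈ (Finset.range (2 ^ t)).filter (fun y => (bigVal (G s y) : ℝ) / 2 ^ a = v),
      (‖waveAmp Real.sin (2 ^ t) θ y‖ ^ 2 + ‖waveAmp Real.cos (2 ^ t) θ y‖ ^ 2) =
      ∑ q ∈ Finset.univ.filter (fun q : Bits t × Bits (n + 1) =>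
        (estimation l t n a G).outValue (Z q) = v),
        ‖(estimation l t n a G).finalState U s (Z q)‖ ^ 2 := by
    rw [Finset.sum_filter, Finset.sum_filter, ← sum_littleVal t, Fintype.sum_prod_type]
    refine Finset.sum_congr rfl fun y _ => ?_
    simp only [hval, hamp]
    split_ifs
    · rw [sum_norm_sq_ketTensor φ₀ φ₁ h₀ h₁]
    · simp
  rw [hsum, QueryAlgorithm.outProb, ← Finset.sum_image (f := fun z =>
    ‖(estimation l t n a G).finalState U s z‖ ^ 2) hZ.injOn]
  -- All other labels contribute nonnegative terms, so nothing has to be known about them.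
  refine Finset.sum_le_sum_of_subset_of_nonneg ?_ fun _ _ _ => by positivity
  intro z hz
  obtain ⟨q, hq, rfl⟩ := Finset.mem_image.1 hz
  exact Finset.mem_filter.2 ⟨Finset.mem_univ _, (Finset.mem_filter.1 hq).2⟩

end Algorithm

/-! ### Rounding to a randomly shifted grid -/

section Rounding

/-- The index of the grid point to which `p` is rounded, with the grid shifted by `s`. -/
noncomputable def gridIndex (l a s : ℕ) (p : ℝ) : ℕ :=
  min ((⌊p * 2 ^ (a + l)⌋₊ + s) / 2 ^ l) (2 ^ a - 1)

lemma gridIndex_lt (l a s : ℕ) (p : ℝ) : gridIndex l a s p < 2 ^ a :=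
  (min_le_right _ _).trans_lt (Nat.sub_lt (by positivity) one_pos)

/-- The uncapped index lies within `1` of `p * 2^a`, since the shift is less than one coarse cell.
The cap, which makes the index fit into `a` bits, preserves this because `p * 2^a ≤ 2^a`. -/
lemma abs_gridIndex_sub_le {l a s : ℕ} (hs : s < 2 ^ l) {p : ℝ} (hp : p ∈ Set.Icc (0 : ℝ) 1) :
    |(gridIndex l a s p : ℝ) / 2 ^ a - p| ≤ 1 / 2 ^ a := by
  have ha : (0 : ℝ) < 2 ^ a := by positivity
  have hl : (0 : ℝ) < 2 ^ l := by positivity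
  have hx : 0 ≤ p * 2 ^ (a + l) := mul_nonneg hp.1 (by positivity)
  have hk := Nat.floor_le hx
  have hk' := Nat.lt_floor_add_one (p * 2 ^ (a + l))
  set k := ⌊p * 2 ^ (a + l)⌋₊ with hkdef
  set m := (k + s) / 2 ^ l with hm
  have hmle : m * 2 ^ l ≤ k + s := Nat.div_mul_le_self _ _
  have hmlt : k + s < (m + 1) * 2 ^ l := by
    rw [add_mul, one_mul]
    exact Nat.lt_div_mul_add (by positivity)
  have hmle' : (m : ℝ) * 2 ^ l ≤ k + s := by exact_mod_cast hmle
  have hmlt' : (k : ℝ) + s + 1 ≤ (m + 1) * 2 ^ l := by exact_mod_cast hmlt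
  have hs' : (s : ℝ) < 2 ^ l := by exact_mod_cast hs
  have hs0 : (0 : ℝ) ≤ s := Nat.cast_nonneg s
  rw [pow_add, ← mul_assoc] at hk hk'
  have hup : (m : ℝ) ≤ p * 2 ^ a + 1 := by
    have : (m : ℝ) * 2 ^ l ≤ (p * 2 ^ a + 1) * 2 ^ l := by linarith
    exact le_of_mul_le_mul_right this hl
  have hlow : p * 2 ^ a ≤ m + 1 := by
    have : p * 2 ^ a * 2 ^ l ≤ (m + 1) * 2 ^ l := by linarith
    exact le_of_mul_le_mul_right this hl
  have hp1 : p * 2 ^ a ≤ 2 ^ a := mul_le_of_le_one_left ha.le hp.2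
  have hg : |(gridIndex l a s p : ℝ) - p * 2 ^ a| ≤ 1 := by
    have hgdef : gridIndex l a s p = min m (2 ^ a - 1) := rfl
    rw [abs_le]
    rcases le_total m (2 ^ a - 1) with h | h
    · rw [hgdef, min_eq_left h]
      constructor <;> linarith
    · have h1 : ((2 ^ a - 1 : ℕ) : ℝ) = 2 ^ a - 1 := by
        rw [Nat.cast_sub Nat.one_le_two_pow]; norm_num
      have h2 : ((2 ^ a - 1 : ℕ) : ℝ) ≤ m := by exact_mod_cast h
      rw [hgdef, min_eq_right h, h1]
      rw [h1] at h2
      constructor <;> linarith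
  have : (gridIndex l a s p : ℝ) / 2 ^ a - p = ((gridIndex l a s p : ℝ) - p * 2 ^ a) / 2 ^ a := by
    field_simp
  rw [this, abs_div, abs_of_pos ha]
  exact div_le_div_of_nonneg_right hg ha.le

/-- Except for one residue class of shifts, numbers close to `p` are rounded like `p`. -/
lemma exists_gridIndex_eq (l a : ℕ) {p : ℝ} (hp : 0 ≤ p) :
    ∃ N : ℕ, ∀ s : ℕ, ¬ 2 ^ l ∣ N + s → ∀ q : ℝ, 0 ≤ q → |q - p| < 1 / 2 ^ (a + l + 1) →
      gridIndex l a s q = gridIndex l a s p := by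
  -- The witness is the integer nearest to `p * 2^(a+l)`, the only boundary of the fine grid that a
  -- nearby `q` can cross.
  refine ⟨⌊p * 2 ^ (a + l) + 1 / 2⌋₊, fun s hs q hq hqp => ?_⟩
  have hpos : (0 : ℝ) < 2 ^ (a + l) := by positivity
  set N := ⌊p * 2 ^ (a + l) + 1 / 2⌋₊ with hN
  have h0 : 0 ≤ p * 2 ^ (a + l) + 1 / 2 := by positivity
  have hN1 := Nat.floor_le h0
  have hN2 := Nat.lt_floor_add_one (p * 2 ^ (a + l) + 1 / 2)
  rw [← hN] at hN1 hN2
  have key : ∀ q : ℝ, 0 ≤ q → |q - p| < 1 / 2 ^ (a + l + 1) →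
      (⌊q * 2 ^ (a + l)⌋₊ + s) / 2 ^ l = (N + s - 1) / 2 ^ l := by
    intro q hq hqp
    have hd : |q * 2 ^ (a + l) - p * 2 ^ (a + l)| < 1 / 2 := by
      rw [← sub_mul, abs_mul, abs_of_pos hpos]
      calc |q - p| * 2 ^ (a + l) < 1 / 2 ^ (a + l + 1) * 2 ^ (a + l) :=
            mul_lt_mul_of_pos_right hqp hpos
        _ = 1 / 2 := by rw [pow_succ]; field_simp
    rw [abs_lt] at hd
    have hx : 0 ≤ q * 2 ^ (a + l) := by positivity
    have hk := Nat.floor_le hx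
    have hk' := Nat.lt_floor_add_one (q * 2 ^ (a + l))
    set k := ⌊q * 2 ^ (a + l)⌋₊
    have h1 : k < N + 1 := by
      have : (k : ℝ) < (N : ℝ) + 1 := by linarith
      exact_mod_cast this
    have h2 : N < k + 2 := by
      have : (N : ℝ) < (k : ℝ) + 2 := by linarith
      exact_mod_cast this
    -- Zero is divisible by `2 ^ l`, so the truncated subtraction in `N + s - 1` is harmless.
    have hNs : N + s ≠ 0 := fun h => hs (h ▸ dvd_zero _)
    have hdiv : (N + s) / 2 ^ l = (N + s - 1) / 2 ^ l := by
      obtain ⟨j, hj⟩ := Nat.exists_eq_succ_of_ne_zero hNs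
      rw [hj, Nat.succ_sub_one, Nat.succ_div_of_not_dvd]
      rwa [← Nat.succ_eq_add_one, ← hj]
    -- The fine index of `q` is `N` or `N - 1`; the coarse quotients differ only when `2 ^ l`
    -- divides `N + s`.
    have hk2 : k + s = N + s ∨ k + s = N + s - 1 := by omega
    rcases hk2 with h | h
    · rw [h, hdiv]
    · rw [h]
  rw [gridIndex, gridIndex, key q hq hqp, key p hp (by simp)]

lemma card_filter_dvd_le_one (l N : ℕ) :
    (Finset.univ.filter fun s : Bits l => 2 ^ l ∣ N + bigVal s).card ≤ 1 := by
  refine Finset.card_le_one.2 fun s hs s' hs' => bigVal_injective l ?_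
  have h := (Finset.mem_filter.1 hs).2
  have h' := (Finset.mem_filter.1 hs').2
  have h1 : N + bigVal s ≡ N + bigVal s' [MOD 2 ^ l] :=
    ((Nat.modEq_zero_iff_dvd).2 h).trans ((Nat.modEq_zero_iff_dvd).2 h').symm
  exact (Nat.ModEq.add_left_cancel' N h1).eq_of_lt_of_lt (bigVal_lt s) (bigVal_lt s')

end Rounding

/-! ### Consistency of the rounded estimate -/

section Estimate

/-- The value of the shifted rounding. -/
noncomputable def shiftedRound (l a : ℕ) (s : Bits l) (p : ℝ) : ℝ :=
  (gridIndex l a (bigVal s) p : ℝ) / 2 ^ a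

lemma shiftedRound_mem (l a : ℕ) (s : Bits l) (p : ℝ) :
    shiftedRound l a s p ∈ Set.Icc (0 : ℝ) 1 := by
  refine ⟨by unfold shiftedRound; positivity, ?_⟩
  rw [shiftedRound, div_le_one (by positivity)]
  exact_mod_cast (gridIndex_lt l a (bigVal s) p).le

/-- The classical postprocessing of amplitude estimation: the digits of the rounded estimate. -/
noncomputable def roundTable (l t a : ℕ) (s : Bits l) (y : ℕ) : Bits a :=
  (exists_bigVal_eq (gridIndex_lt l a (bigVal s)
    (Real.sin (Real.pi * y / (2 ^ t : ℕ)) ^ 2))).choose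

lemma bigVal_roundTable (l t a : ℕ) (s : Bits l) (y : ℕ) :
    bigVal (roundTable l t a s y) =
      gridIndex l a (bigVal s) (Real.sin (Real.pi * y / (2 ^ t : ℕ)) ^ 2) :=
  (exists_bigVal_eq (gridIndex_lt l a (bigVal s) _)).choose_spec

lemma outProb_nonneg {n l : ℕ} (A : QueryAlgorithm n l)
    (U : Matrix (Bits (n + 1)) (Bits (n + 1)) ℂ) (s : Bits l) (v : ℝ) : 0 ≤ A.outProb U s v :=
  Finset.sum_nonneg fun _ _ => by positivity

lemma le_randProb {l : ℕ} {E : Bits l → Prop} {S : Finset (Bits l)} (h : ∀ s ∈ S, E s) :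
    (S.card : ℝ) / 2 ^ l ≤ randProb l E := by
  classical
  unfold randProb
  refine div_le_div_of_nonneg_right (Nat.cast_le.2 (Finset.card_le_card fun s hs => ?_))
    (by positivity)
  rw [Finset.mem_filter]
  exact ⟨Finset.mem_univ _, h s hs⟩

/-- Except for at most one random string, the output is consistent. -/
lemma exists_le_outProb (n l a : ℕ) (U : Matrix (Bits (n + 1)) (Bits (n + 1)) ℂ) (p : ℝ)
    (h : PreparesAmplitude U p) :
    ∃ N : ℕ, ∀ s : Bits l, ¬ 2 ^ l ∣ N + bigVal s →
      1 - 1 / 2 ^ l ≤ (estimation l (a + 2 * l + 7) n a (roundTable l (a + 2 * l + 7) a)).outProb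
        U s (shiftedRound l a s p) := by
  obtain ⟨hUmem, hp, φ₀, φ₁, h₀, h₁, hψ⟩ := h
  have hU : U * Uᴴ = 1 := by
    rw [← Matrix.star_eq_conjTranspose]
    exact Matrix.mem_unitaryGroup_iff.1 hUmem
  obtain ⟨N, hN⟩ := exists_gridIndex_eq l a hp.1
  refine ⟨N, fun s hs => ?_⟩
  set t := a + 2 * l + 7 with ht
  set θ := Real.arcsin (Real.sqrt p) with hθ
  have hsin : Real.sin θ = Real.sqrt p :=
    Real.sin_arcsin (by linarith [Real.sqrt_nonneg p]) (Real.sqrt_le_one.2 hp.2)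
  have hcos : Real.cos θ = Real.sqrt (1 - p) := by
    rw [hθ, Real.cos_arcsin, Real.sq_sqrt hp.1]
  rw [← hsin, ← hcos] at hψ
  have hout := le_outProb_estimation (t := t) (roundTable l t a) U hU h₀ h₁ hψ s
    (shiftedRound l a s p)
  refine le_trans ?_ hout
  -- The choice of `t`: with `η = 2^-(a+l+1)` the failure bound `64 / (M * η)` becomes exactly
  -- `2^-l`.
  have hMη : ((2 ^ t : ℕ) : ℝ) * (1 / 2 ^ (a + l + 1)) = 64 * 2 ^ l := by
    rw [ht]
    push_cast
    have : (2 : ℝ) ^ (a + 2 * l + 7) = 2 ^ (a + l + 1) * (64 * 2 ^ l) := by ring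
    rw [this]
    field_simp
  have hest := le_sum_norm_sq_waveAmp (M := 2 ^ t) (η := 1 / 2 ^ (a + l + 1)) (by positivity)
    (by rw [div_le_one (by positivity)]; exact one_le_pow₀ one_le_two)
    (by rw [hMη]; linarith [one_le_pow₀ (M₀ := ℝ) (n := l) one_le_two]) θ
  have h64 : (64 : ℝ) / (64 * 2 ^ l) = 1 / 2 ^ l := by field_simp
  rw [hMη, h64] at hest
  refine hest.trans (Finset.sum_le_sum_of_subset_of_nonneg ?_ fun _ _ _ => by positivity)
  intro y hy
  rw [Finset.mem_filter] at hy ⊢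
  refine ⟨hy.1, ?_⟩
  rw [bigVal_roundTable, shiftedRound, hN (bigVal s) hs _ (sq_nonneg _)]
  -- The estimate has error at most `η / 2`; halving supplies the strict inequality `< η` that the
  -- rounding needs.
  refine lt_of_le_of_lt (b := 1 / 2 ^ (a + l + 1) / 2) ?_ (half_lt_self (by positivity))
  have h2 := hy.2
  rwa [hsin, Real.sq_sqrt hp.1] at h2

end Estimate

/-! ### Numerical bounds for the resources -/

section Bounds

lemma one_le_log_two_add {x : ℝ} (hx : 1 ≤ x) : 1 ≤ Real.log (2 + x) := by
  rw [Real.le_log_iff_exp_le (by linarith)]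
  linarith [Real.exp_one_lt_d9]

lemma exists_two_pow_near {x : ℝ} (hx : 1 ≤ x) : ∃ m : ℕ, x ≤ 2 ^ m ∧ (2 : ℝ) ^ m ≤ 2 * x := by
  obtain ⟨m, h1, h2⟩ := exists_nat_pow_near hx one_lt_two
  refine ⟨m + 1, h2.le, ?_⟩
  rw [pow_succ]
  linarith

/-- The factor `2` is room for `1 / log 2`. -/
lemma le_log_of_two_pow_le {m : ℕ} {x c : ℝ} (hx : 1 ≤ x) (hc : 0 < c)
    (h : (2 : ℝ) ^ m ≤ c * x) : (m : ℝ) ≤ 2 * (Real.log c + Real.log (2 + x)) := by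
  have h1 := Real.log_le_log (by positivity) h
  rw [Real.log_pow, Real.log_mul hc.ne' (by linarith)] at h1
  have h2 : Real.log x ≤ Real.log (2 + x) := Real.log_le_log (by linarith) (by linarith)
  have h3 := Real.log_two_gt_d9
  have h4 : (0 : ℝ) ≤ m := Nat.cast_nonneg m
  nlinarith

lemma two_pow_le {l a : ℕ} {D E : ℝ} (hl : (2 : ℝ) ^ l ≤ 4 * E) (ha : (2 : ℝ) ^ a ≤ 2 * D) :
    (2 : ℝ) ^ (a + 2 * l + 7) ≤ 4096 * (D * E ^ 2) := by
  have h1 : ((2 : ℝ) ^ l) ^ 2 ≤ (4 * E) ^ 2 := pow_le_pow_left₀ (by positivity) hl 2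
  have h2 : (2 : ℝ) ^ a * ((2 : ℝ) ^ l) ^ 2 ≤ 2 * D * (4 * E) ^ 2 :=
    mul_le_mul ha h1 (by positivity) (le_trans (by positivity) ha)
  calc (2 : ℝ) ^ (a + 2 * l + 7) = 128 * (2 ^ a * ((2 : ℝ) ^ l) ^ 2) := by ring
    _ ≤ 128 * (2 * D * (4 * E) ^ 2) := by linarith
    _ = 4096 * (D * E ^ 2) := by ring

lemma query_bound_le {l a : ℕ} {D E Λ : ℝ} (hD : 1 ≤ D) (hE : 1 ≤ E) (hΛ : 1 ≤ Λ)
    (hl : (2 : ℝ) ^ l ≤ 4 * E) (ha : (2 : ℝ) ^ a ≤ 2 * D) :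
    2 * (2 : ℝ) ^ (a + 2 * l + 7) + 1 ≤ 30000000 * (D * Λ ^ 4) * E ^ 4 := by
  have h1 := two_pow_le hl ha
  have hΛ4 : 1 ≤ Λ ^ 4 := one_le_pow₀ hΛ
  have h2 : D * E ^ 2 ≤ D * Λ ^ 4 * E ^ 4 := by
    refine mul_le_mul (le_mul_of_one_le_right (by linarith) hΛ4)
      (pow_le_pow_right₀ hE (by norm_num)) (by positivity) (by positivity)
  have h3 : 1 ≤ D * E ^ 2 := one_le_mul_of_one_le_of_one_le hD (one_le_pow₀ hE)
  linarith

/-- The summands are the Fourier transforms with the initial query, the Grover powers and the table.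
The table dominates in `E`: its size, the output length and the number of controls contribute `E *
(D * E^2) * Λ * (Λ * E)`, which accounts for the exponent `4`. -/
lemma time_bound_le {n l a : ℕ} {D E Λ : ℝ} (hD : 1 ≤ D) (hE : 1 ≤ E) (hΛ : 1 ≤ Λ)
    (hl : (2 : ℝ) ^ l ≤ 4 * E) (ha : (2 : ℝ) ^ a ≤ 2 * D) (haΛ : (a : ℝ) ≤ 4 * Λ) :
    2 * (((a + 2 * l + 7 : ℕ) : ℝ) + 1) ^ 2 + 1 + 34 * ((n : ℝ) + 1) * 2 ^ (a + 2 * l + 7) +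
      2 ^ l * 2 ^ (a + 2 * l + 7) * a * (14 * ((l : ℝ) + (a + 2 * l + 7 : ℕ)) + 1) ≤
        30000000 * ((n : ℝ) + 1) * (D * Λ ^ 4) * E ^ 4 := by
  have hn : (1 : ℝ) ≤ (n : ℝ) + 1 := by linarith [n.cast_nonneg (α := ℝ)]
  have hll : (l : ℝ) ≤ 4 * E := le_trans (by exact_mod_cast Nat.lt_two_pow_self.le) hl
  have hT := two_pow_le hl ha
  have hΛE : Λ ≤ Λ * E := le_mul_of_one_le_right (by linarith) hE
  have hEΛ : E ≤ Λ * E := le_mul_of_one_le_left (by linarith) hΛ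
  -- From `a ≤ 4 * Λ`, `l ≤ 4 * E` and `1 ≤ Λ * E`: `4 + 8 + 7 = 19`.
  have ht : ((a + 2 * l + 7 : ℕ) : ℝ) ≤ 19 * (Λ * E) := by
    push_cast
    linarith
  have hX : 1 ≤ Λ * E := hΛ.trans hΛE
  set t : ℝ := ((a + 2 * l + 7 : ℕ) : ℝ)
  set T : ℝ := (2 : ℝ) ^ (a + 2 * l + 7)
  have ht0 : 0 ≤ t := Nat.cast_nonneg _
  have hT0 : 0 < T := by positivity
  set B : ℝ := ((n : ℝ) + 1) * (D * Λ ^ 4) * E ^ 4 with hB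
  have hDΛ : 1 ≤ D * Λ ^ 4 := one_le_mul_of_one_le_of_one_le hD (one_le_pow₀ hΛ)
  have hnD : 1 ≤ ((n : ℝ) + 1) * D := one_le_mul_of_one_le_of_one_le hn hD
  have h1 : 2 * (t + 1) ^ 2 + 1 ≤ 801 * B := by
    have e1 : (t + 1) ^ 2 ≤ (20 * (Λ * E)) ^ 2 := pow_le_pow_left₀ (by linarith) (by linarith) 2
    have e2 : (1 : ℝ) ≤ (Λ * E) ^ 2 := one_le_pow₀ hX
    have e3 : (Λ * E) ^ 2 ≤ B := by
      calc (Λ * E) ^ 2 ≤ (Λ * E) ^ 4 := pow_le_pow_right₀ hX (by norm_num)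
        _ ≤ ((n : ℝ) + 1) * D * (Λ * E) ^ 4 := le_mul_of_one_le_left (by positivity) hnD
        _ = B := by rw [hB]; ring
    linarith
  have h2 : 34 * ((n : ℝ) + 1) * T ≤ 139264 * B := by
    calc 34 * ((n : ℝ) + 1) * T ≤ 34 * ((n : ℝ) + 1) * (4096 * (D * E ^ 2)) :=
          mul_le_mul_of_nonneg_left hT (by positivity)
      _ = 139264 * (((n : ℝ) + 1) * (D * 1) * E ^ 2) := by ring
      _ ≤ 139264 * B := by
        rw [hB]
        have e1 : (1 : ℝ) ≤ Λ ^ 4 := one_le_pow₀ hΛ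
        have e2 : E ^ 2 ≤ E ^ 4 := pow_le_pow_right₀ hE (by norm_num)
        gcongr
  have h3 : 2 ^ l * T * a * (14 * ((l : ℝ) + t) + 1) ≤ 21168128 * B := by
    have e1 : 14 * ((l : ℝ) + t) + 1 ≤ 323 * (Λ * E) := by linarith
    calc 2 ^ l * T * a * (14 * ((l : ℝ) + t) + 1) ≤
          (4 * E) * (4096 * (D * E ^ 2)) * (4 * Λ) * (323 * (Λ * E)) := by gcongr
      _ = 21168128 * (1 * (D * Λ ^ 2) * E ^ 4) := by ring
      _ ≤ 21168128 * B := by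
        rw [hB]
        have e2 : Λ ^ 2 ≤ Λ ^ 4 := pow_le_pow_right₀ hΛ (by norm_num)
        gcongr
  have hB1 : 0 ≤ B := by positivity
  calc _ ≤ 801 * B + 139264 * B + 21168128 * B := add_le_add (add_le_add h1 h2) h3
    _ ≤ 30000000 * B := by linarith
    _ = _ := by rw [hB]; ring

end Bounds

/-! ### The case of large parameters and the theorem -/

/-- The algorithm without any step. -/
def trivialAlgorithm (n : ℕ) : QueryAlgorithm n 0 where
  width := 0
  outLen := 0
  inWires := Function.Embedding.refl _
  outWires := Function.Embedding.refl _
  steps := []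

lemma outProb_trivialAlgorithm (n : ℕ) (U : Matrix (Bits (n + 1)) (Bits (n + 1)) ℂ) (s : Bits 0) :
    (trivialAlgorithm n).outProb U s 0 = 1 := by
  have h : ∀ x, (trivialAlgorithm n).outValue x = 0 := fun x => Fin.sum_univ_zero _
  have h2 : (trivialAlgorithm n).finalState U s = ket ((trivialAlgorithm n).start s) := by
    change (1 : Matrix _ _ ℂ) *ᵥ _ = _
    exact Matrix.one_mulVec _
  rw [QueryAlgorithm.outProb, h2]
  simp only [h, Finset.filter_true]
  rw [Finset.sum_eq_single ((trivialAlgorithm n).start s)]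
  · simp [ket]
  · intro x _ hx
    simp [ket, hx]
  · simp

end QAmp

open QAmp in
theorem mainTheorem6 :
    ∃ (K : ℝ) (k : ℕ), ∀ ε δ : ℝ, 0 < ε → 0 < δ →
      ∃ (l : ℕ) (f : QAmp.Bits l → ℝ → ℝ),
        (l : ℝ) ≤ K * Real.log (2 + 1 / ε) ∧
        (∀ s, ∀ p ∈ Set.Icc (0 : ℝ) 1, f s p ∈ Set.Icc (0 : ℝ) 1) ∧
        ∀ n : ℕ, ∃ A : QAmp.QueryAlgorithm n l,
          (A.queries : ℝ) ≤ K * ((1 / δ) * Real.log (2 + 1 / δ) ^ k) * (1 + 1 / ε) ^ k ∧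
          (A.time : ℝ) ≤
            K * (n + 1) * ((1 / δ) * Real.log (2 + 1 / δ) ^ k) * (1 + 1 / ε) ^ k ∧
          ∀ (U : Matrix (QAmp.Bits (n + 1)) (QAmp.Bits (n + 1)) ℂ) (p : ℝ),
            QAmp.PreparesAmplitude U p →
              1 - ε ≤ QAmp.randProb l
                (fun s => |f s p - p| ≤ δ ∧ 1 - ε ≤ A.outProb U s (f s p)) ∧
              1 - ε ≤ QAmp.randMean l
                (fun s => open Classical in
                  if |f s p - p| ≤ δ then A.outProb U s (f s p) else 0) := by
  refine ⟨30000000, 4, fun ε δ hε hδ => ?_⟩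
  -- For large `δ` the budget may not allow a single step, so the empty circuit with output `0` is
  -- used. It is within `δ` of `p` when `1 ≤ δ`, and both bounds are void when `1 ≤ ε`.
  by_cases hcase : 1 ≤ ε ∨ 1 ≤ δ
  · have hlogε : 0 ≤ Real.log (2 + 1 / ε) := Real.log_nonneg (by
      have : 0 < 1 / ε := by positivity
      linarith)
    have hlogδ : 0 ≤ Real.log (2 + 1 / δ) := Real.log_nonneg (by
      have : 0 < 1 / δ := by positivity
      linarith)
    refine ⟨0, fun _ _ => 0, by simpa using hlogε, fun _ _ _ => by simp, fun n =>
      ⟨trivialAlgorithm n, ?_, ?_, fun U p hU => ?_⟩⟩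
    · have : (trivialAlgorithm n).queries = 0 := rfl
      rw [this, Nat.cast_zero]
      positivity
    · have : (trivialAlgorithm n).time = 0 := rfl
      rw [this, Nat.cast_zero]
      positivity
    · have hp := hU.2.1
      simp only [outProb_trivialAlgorithm]
      rcases hcase with h | h
      · refine ⟨le_trans (sub_nonpos.2 h) ?_, le_trans (sub_nonpos.2 h) ?_⟩
        · unfold randProb; positivity
        · unfold randMean
          refine div_nonneg (Finset.sum_nonneg fun s _ => ?_) (by positivity)
          split_ifs <;> norm_num
      · have hpδ : |0 - p| ≤ δ := by
          rw [zero_sub, abs_neg, abs_of_nonneg hp.1]; exact hp.2.trans h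
        simp only [hpδ, true_and, if_true, randProb, randMean]
        have : 1 - ε ≤ 1 := by linarith
        simp [this]
  · push Not at hcase
    obtain ⟨hε1, hδ1⟩ := hcase
    have hE1 : 1 ≤ 1 / ε := by rw [le_div_iff₀ hε]; linarith
    have hD1 : 1 ≤ 1 / δ := by rw [le_div_iff₀ hδ]; linarith
    -- The choice `2 / ε ≤ 2^l` leaves `ε / 2` for the bad shift and `ε / 2` for the failure of the
    -- estimate.
    obtain ⟨l, hl1, hl2⟩ := exists_two_pow_near (x := 2 * (1 / ε)) (by linarith)
    obtain ⟨a, ha1, ha2⟩ := exists_two_pow_near hD1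
    have hlog2 : Real.log 2 ≤ 1 := by linarith [Real.log_two_lt_d9]
    have hlog4 : Real.log 4 ≤ 2 := by
      have : (4 : ℝ) = 2 ^ 2 := by norm_num
      rw [this, Real.log_pow]; push_cast; linarith
    have hl2' : (2 : ℝ) ^ l ≤ 4 * (1 / ε) := by linarith
    have hl4 : (2 : ℝ) ^ l ≤ 4 * (1 + 1 / ε) := by linarith
    have hlbd := le_log_of_two_pow_le hE1 (by norm_num) hl2'
    have habd := le_log_of_two_pow_le hD1 (by norm_num) ha2
    have hlogε := one_le_log_two_add hE1
    have hlogδ := one_le_log_two_add hD1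
    have hLε : 1 / (2 : ℝ) ^ l ≤ ε / 2 := by
      rw [div_le_iff₀ (by positivity)]
      have := mul_le_mul_of_nonneg_left hl1 (by positivity : 0 ≤ ε / 2)
      have h1 : ε / 2 * (2 * (1 / ε)) = 1 := by field_simp
      linarith
    have haδ : 1 / (2 : ℝ) ^ a ≤ δ := by
      rw [div_le_iff₀ (by positivity)]
      have := mul_le_mul_of_nonneg_left ha1 hδ.le
      have h1 : δ * (1 / δ) = 1 := by field_simp
      linarith
    refine ⟨l, shiftedRound l a, by nlinarith, fun s p _ => shiftedRound_mem l a s p, fun n =>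
      ⟨estimation l (a + 2 * l + 7) n a (roundTable l (a + 2 * l + 7) a), ?_, ?_,
        fun U p hUp => ?_⟩⟩
    · refine le_trans (Nat.cast_le.2 (queries_estimation_le _)) ?_
      have := query_bound_le hD1 (by linarith) hlogδ hl4 ha2
      push_cast
      exact this
    · refine le_trans (Nat.cast_le.2 (time_estimation_le _)) ?_
      have := time_bound_le (n := n) hD1 (by linarith) hlogδ hl4 ha2 (by linarith)
      push_cast at this ⊢
      exact this
    · obtain ⟨N, hN⟩ := exists_le_outProb n l a U p hUp
      set A := estimation l (a + 2 * l + 7) n a (roundTable l (a + 2 * l + 7) a)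
      have hclose : ∀ s, |shiftedRound l a s p - p| ≤ δ := fun s =>
        (abs_gridIndex_sub_le (bigVal_lt s) hUp.2.1).trans haδ
      classical
      set good := Finset.univ.filter fun s : Bits l => ¬ 2 ^ l ∣ N + bigVal s with hgood
      have hcard : (2 : ℝ) ^ l - 1 ≤ good.card := by
        have h1 := card_filter_dvd_le_one l N
        have h2 := Finset.card_filter_add_card_filter_not (s := (Finset.univ : Finset (Bits l)))
          (fun s => 2 ^ l ∣ N + bigVal s)
        rw [← hgood, Finset.card_univ, Fintype.card_fun, Fintype.card_fin, Fintype.card_fin] at h2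
        have h3 : 2 ^ l ≤ good.card + 1 := by omega
        have h4 : (2 : ℝ) ^ l ≤ good.card + 1 := by exact_mod_cast h3
        linarith
      have hcard' : 1 - 1 / (2 : ℝ) ^ l ≤ good.card / 2 ^ l := by
        rw [le_div_iff₀ (by positivity), sub_mul, div_mul_cancel₀ _ (by positivity)]
        linarith
      have hgoodp : ∀ s ∈ good, 1 - 1 / 2 ^ l ≤ A.outProb U s (shiftedRound l a s p) :=
        fun s hs => hN s (Finset.mem_filter.1 hs).2
      constructor
      · calc 1 - ε ≤ good.card / 2 ^ l := by linarith
          _ ≤ _ := by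
            refine le_randProb fun s hs => ⟨hclose s, ?_⟩
            linarith [hgoodp s hs]
      · unfold randMean
        simp only [hclose, if_true]
        have h1 : (good.card : ℝ) * (1 - 1 / 2 ^ l) ≤
            ∑ s, A.outProb U s (shiftedRound l a s p) := by
          rw [← nsmul_eq_mul]
          refine (Finset.card_nsmul_le_sum good _ _ hgoodp).trans ?_
          exact Finset.sum_le_sum_of_subset_of_nonneg (Finset.subset_univ _)
            fun s _ _ => outProb_nonneg _ _ _ _
        have h0 : 0 ≤ 1 - 1 / (2 : ℝ) ^ l := by linarith
        -- A good shift and a successful measurement: `(1 - ε/2)^2 ≥ 1 - ε`.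
        calc 1 - ε ≤ (1 - 1 / (2 : ℝ) ^ l) * (1 - 1 / 2 ^ l) := by nlinarith
          _ ≤ good.card / 2 ^ l * (1 - 1 / 2 ^ l) := mul_le_mul_of_nonneg_right hcard' h0
          _ = good.card * (1 - 1 / 2 ^ l) / 2 ^ l := by ring
          _ ≤ _ := div_le_div_of_nonneg_right h1 (by positivity)
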